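/- A \emph{Brouwer--Zadeh lattice} (BZ-lattice) is an algebra $(L,\wedge,\vee,{}',{}^{\sim},0,1)$ such that $(L,\wedge,\vee,0,1)$ is a bounded lattice, ${}'$ is an order-reversing involution with $a\wedge a'\le b\vee b'$, and ${}^{\sim}$ is order-reversing with $a\wedge a^{\sim}=0$ and $a\le a^{\sim\sim}=a^{\sim\prime}$, for all $a,b\in L$. A \emph{PBZ$^*$-lattice} is a BZ-lattice that satisfies $(x\wedge x')^{\sim}\approx x^{\sim}\vee x'^{\sim}$ and is paraorthomodular: $a\le b$ and $a'\wedge b=0$ imply $a=b$. An \emph{antiortholattice} is a PBZ$^*$-lattice in which $a\vee a'=1$ only for $a\in\{0,1\}$. For a class $\mathbb C$ of BZ-lattices let $V(\mathbb C)=\mathrm{HSP}(\mathbb C)$ be the variety of BZ-lattices generated by $\mathbb C$. For varieties $\mathbb V,\mathbb W$ of BZ-lattices let $\mathbb V\vee\mathbb W=V(\mathbb V\cup\mathbb W)$, and let $\mathbb V\times_s\mathbb W$ be the class of all algebras isomorphic to a subdirect product of a member of $\mathbb V$ and a member of $\mathbb W$. Let - $\mathbb{OML}$ be the variety of orthomodular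 lattices, each endowed with the Brouwer complement $x^{\sim}=x'$; - $\mathbb{AOL}$ be the class of antiortholattices; - $\mathbb{DIST}$ be the variety of distributive PBZ$^*$-lattices; - $\mathbb{SAOL}$ be the variety of the members of $V(\mathbb{AOL})$ that satisfy $(x\wedge y)^{\sim}\approx x^{\sim}\vee y^{\sim}$; - $\mathbf D_n$ be the antiortholattice on the $n$-element chain (with $0^{\sim}=1$ and $a^{\sim}=0$ for $a\ne0$). Then: 1. $\mathbb{OML}\vee\mathbb{DIST}=\mathbb{OML}\times_s\mathbb{DIST}$ and $\mathbb{OML}\vee V(\mathbf D_5)=\mathbb{OML}\times_s V(\mathbf D_5)$. 2. $\mathbb{OML}\vee V(\mathbf D_3)\subsetneq\mathbb{OML}\vee V(\mathbf D_5)=\mathbb{OML}\vee(\mathbb{SAOL}\cap\mathbb{DIST})=(\mathbb{OML}\vee\mathbb{SAOL})\cap(\mathbb{OML}\vee\mathbb{DIST})$; this last class is strictly contained in each of $\mathbb{OML}\vee\mathbb{SAOL}$ and $\mathbb{OML}\vee\mathbb{DIST}$, each of which is strictly contained in $\mathbb{OML}\vee\mathbb{SAOL}\vee\mathbb{DIST}$;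 and $\mathbb{OML}\vee\mathbb{SAOL}\vee\mathbb{DIST}\subsetneq\mathbb{OML}\vee V(\mathbb{AOL})$. In particular, $\mathbb{OML}\vee\mathbb{SAOL}$ and $\mathbb{OML}\vee\mathbb{DIST}$ are incomparable: neither contains the other. -/

import Mathlib

universe u v

/-- Brouwer-Zadeh lattices, as algebras of type `(2,2,1,1,0,0)`: a bounded lattice with a Kleene
complement `kl` (so that the reduct is a pseudo-Kleene algebra) and a Brouwer complement `br`. -/
class BZLattice (L : Type u) extends Lattice L, BoundedOrder L where
  /-- the Kleene complement `a ↦ a'` -/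
  kl : L → L
  /-- the Brouwer complement `a ↦ a~` -/
  br : L → L
  kl_anti : ∀ a b : L, a ≤ b → kl b ≤ kl a
  kl_kl : ∀ a : L, kl (kl a) = a
  inf_kl_le_sup_kl : ∀ a b : L, a ⊓ kl a ≤ b ⊔ kl b
  br_anti : ∀ a b : L, a ≤ b → br b ≤ br a
  inf_br : ∀ a : L, a ⊓ br a = ⊥
  le_br_br : ∀ a : L, a ≤ br (br a)
  br_br : ∀ a : L, br (br a) = kl (br a)

namespace BZLattice

/-- Direct products, with componentwise operations. -/
instance instPi {I : Type v} (L : I → Type u) [∀ i, BZLattice (L i)] :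
    BZLattice (∀ i, L i) where
  kl a i := kl (a i)
  br a i := br (a i)
  kl_anti _ _ h i := kl_anti _ _ (h i)
  kl_kl _ := funext fun _ => kl_kl _
  inf_kl_le_sup_kl _ _ _ := inf_kl_le_sup_kl _ _
  br_anti _ _ h i := br_anti _ _ (h i)
  inf_br _ := funext fun _ => inf_br _
  le_br_br _ _ := le_br_br _
  br_br _ := funext fun _ => br_br _

/-- Binary direct products, with componentwise operations. -/
instance instProd (L : Type u) (M : Type v) [BZLattice L] [BZLattice M] :
    BZLattice (L × M) where
  kl a := (kl a.1, kl a.2)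
  br a := (br a.1, br a.2)
  kl_anti _ _ h := ⟨kl_anti _ _ h.1, kl_anti _ _ h.2⟩
  kl_kl _ := Prod.ext (kl_kl _) (kl_kl _)
  inf_kl_le_sup_kl _ _ := ⟨inf_kl_le_sup_kl _ _, inf_kl_le_sup_kl _ _⟩
  br_anti _ _ h := ⟨br_anti _ _ h.1, br_anti _ _ h.2⟩
  inf_br _ := Prod.ext (inf_br _) (inf_br _)
  le_br_br _ := ⟨le_br_br _, le_br_br _⟩
  br_br _ := Prod.ext (br_br _) (br_br _)

/-- The `n`-element chain with its order-reversing involution and the trivial Brouwer complement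
(`0~ = 1` and `a~ = 0` for `a ≠ 0`). -/
instance instChain (n : ℕ) [NeZero n] : BZLattice (ULift.{u} (Fin n)) where
  sup a b := ⟨max a.down b.down⟩
  inf a b := ⟨min a.down b.down⟩
  le_sup_left a b := (le_max_left a.down b.down :)
  le_sup_right a b := (le_max_right a.down b.down :)
  sup_le a b c h k := (max_le h k : max a.down b.down ≤ c.down)
  inf_le_left a b := (min_le_left a.down b.down :)
  inf_le_right a b := (min_le_right a.down b.down :)
  le_inf a b c h k := (le_min h k : a.down ≤ min b.down c.down)
  top := ⟨Fin.rev 0⟩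
  bot := ⟨0⟩
  le_top a := (by rw [← Fin.rev_le_rev, Fin.rev_rev]; exact Fin.zero_le _ :
    a.down ≤ Fin.rev 0)
  bot_le a := (Fin.zero_le a.down :)
  kl a := ⟨a.down.rev⟩
  br a := if a.down = 0 then ⟨Fin.rev 0⟩ else ⟨0⟩
  kl_anti a b h := Fin.rev_le_rev.mpr h
  kl_kl a := by simp
  inf_kl_le_sup_kl a b := by
    change min a.down a.down.rev ≤ max b.down b.down.rev
    rcases le_total a.down b.down with h | h
    · exact (min_le_left _ _).trans (h.trans (le_max_left _ _))
    · exact (min_le_right _ _).trans ((Fin.rev_le_rev.mpr h).trans (le_max_right _ _))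
  br_anti a b h := by
    have h' : a.down ≤ b.down := h
    split_ifs with hb ha ha
    · exact le_rfl
    · exact absurd (nonpos_iff_eq_zero.mp (hb ▸ h')) ha
    · exact Fin.zero_le (Fin.rev (0 : Fin n))
    · exact le_rfl
  inf_br a := by
    apply ULift.ext
    change min a.down (ULift.down (if a.down = 0 then ⟨Fin.rev 0⟩ else ⟨0⟩)) = 0
    split_ifs with h
    · rw [h]; exact min_eq_left (Fin.zero_le _)
    · exact min_eq_right (Fin.zero_le _)
  le_br_br a := by
    by_cases h : a.down = 0
    · exact h.trans_le (Fin.zero_le _)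
    · simp only [h, if_false, if_true]
      change a.down ≤ Fin.rev 0
      rw [← Fin.rev_le_rev, Fin.rev_rev]; exact Fin.zero_le _
  br_br a := by
    by_cases h : a.down = 0
    · by_cases h0 : Fin.rev (0 : Fin n) = 0 <;> simp [h, h0]
    · simp [h]

end BZLattice

/-- Homomorphisms of Brouwer-Zadeh lattices (preserving all six basic operations). -/
structure BZHom (L : Type u) (M : Type v) [BZLattice L] [BZLattice M] extends
    BoundedLatticeHom L M where
  map_kl : ∀ a : L, toFun (BZLattice.kl a) = BZLattice.kl (toFun a)
  map_br : ∀ a : L, toFun (BZLattice.br a) = BZLattice.br (toFun a)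

/-- Brouwer-Zadeh lattices with universe in `Type u`; classes of such algebras are elements of
`Set BZLat.{u}`. -/
structure BZLat : Type (u + 1) where
  carrier : Type u
  [str : BZLattice carrier]

namespace BZLat

open BZLattice

instance : CoeSort BZLat.{u} (Type u) := ⟨BZLat.carrier⟩

instance (A : BZLat.{u}) : BZLattice A := A.str

/-! ### Class operators -/

/-- Homomorphic images of members of `C`. -/
def H (C : Set BZLat.{u}) : Set BZLat.{u} :=
  {A | ∃ B ∈ C, ∃ f : BZHom B A, Function.Surjective f.toFun}

/-- (Isomorphic copies of) subalgebras of members of `C`. -/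
def S (C : Set BZLat.{u}) : Set BZLat.{u} :=
  {A | ∃ B ∈ C, ∃ f : BZHom A B, Function.Injective f.toFun}

/-- (Isomorphic copies of) direct products of families of members of `C`. -/
def P (C : Set BZLat.{u}) : Set BZLat.{u} :=
  {A | ∃ (I : Type u) (B : I → BZLat.{u}), (∀ i, B i ∈ C) ∧
    ∃ f : BZHom A (∀ i, B i), Function.Bijective f.toFun}

/-- The variety of Brouwer-Zadeh lattices generated by `C`. -/
def V (C : Set BZLat.{u}) : Set BZLat.{u} := H (S (P C))

/-- The join of two varieties of Brouwer-Zadeh lattices: the variety generated by their union. -/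
def join (C D : Set BZLat.{u}) : Set BZLat.{u} := V (C ∪ D)

/-- The subdirect product of two classes: all algebras isomorphic to a subdirect product of a
member of `C` and a member of `D`, that is, to a subalgebra of `B × B'` which is mapped onto each
of the factors by the projections. -/
def subdirectProduct (C D : Set BZLat.{u}) : Set BZLat.{u} :=
  {A | ∃ B ∈ C, ∃ B' ∈ D, ∃ f : BZHom A (B × B'), Function.Injective f.toFun ∧
    Function.Surjective (fun a => (f.toFun a).1) ∧ Function.Surjective (fun a => (f.toFun a).2)}

/-! ### The varieties of the statement -/

/-- An element `a` is sharp if `a ∨ a' = 1`. -/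
def IsSharp {L : Type u} [BZLattice L] (a : L) : Prop := a ⊔ kl a = ⊤

/-- PBZ*-lattices: paraorthomodular Brouwer-Zadeh lattices with `(x ∧ x')~ = x~ ∨ x'~`. -/
def PBZL : Set BZLat.{u} :=
  {A | (∀ a b : A, a ≤ b → kl a ⊓ b = ⊥ → a = b) ∧
    ∀ a : A, br (a ⊓ kl a) = br a ⊔ br (kl a)}

/-- Orthomodular lattices, endowed with a Brouwer complement equal to the Kleene complement. -/
def OML : Set BZLat.{u} :=
  {A | (∀ a b : A, a ≤ b → b = (b ⊓ kl a) ⊔ a) ∧ ∀ a : A, br a = kl a}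

/-- Antiortholattices: PBZ*-lattices with no sharp elements besides `0` and `1`. -/
def AOL : Set BZLat.{u} :=
  {A | A ∈ PBZL ∧ ∀ a : A, IsSharp a → a = ⊥ ∨ a = ⊤}

/-- Distributive PBZ*-lattices. -/
def DIST : Set BZLat.{u} :=
  {A | A ∈ PBZL ∧ ∀ a b c : A, a ⊓ (b ⊔ c) = (a ⊓ b) ⊔ (a ⊓ c)}

/-- PBZ*-lattices with the strong De Morgan identity `(x ∧ y)~ = x~ ∨ y~`. -/
def SDM : Set BZLat.{u} :=
  {A | A ∈ PBZL ∧ ∀ a b : A, br (a ⊓ b) = br a ⊔ br b}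

/-- `SAOL = SDM ∩ V(AOL)`. -/
def SAOL : Set BZLat.{u} := SDM ∩ V AOL

/-- The antiortholattice on the `n`-element chain. -/
abbrev chain (n : ℕ) [NeZero n] : BZLat.{u} := ⟨ULift.{u} (Fin n)⟩

/-- Sanity check: `OML` is the subvariety of `PBZL` given by the identity `x' = x~`. -/
theorem mem_OML_iff (A : BZLat.{u}) : A ∈ OML ↔ A ∈ PBZL ∧ ∀ a : A, kl a = br a := by
  have key : ∀ a b : A, kl (a ⊔ b) = kl a ⊓ kl b := fun a b => by
    apply le_antisymm
    · exact le_inf (kl_anti _ _ le_sup_left) (kl_anti _ _ le_sup_right)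
    · rw [← kl_kl (kl a ⊓ kl b)]
      refine kl_anti _ _ (sup_le ?_ ?_)
      · conv_lhs => rw [← kl_kl a]
        exact kl_anti _ _ inf_le_left
      · conv_lhs => rw [← kl_kl b]
        exact kl_anti _ _ inf_le_right
  have key' : ∀ a b : A, kl (a ⊓ b) = kl a ⊔ kl b := fun a b => by
    rw [← kl_kl (kl a ⊔ kl b), key, kl_kl, kl_kl]
  constructor
  · rintro ⟨h1, h2⟩
    refine ⟨⟨fun a b hab h => ?_, fun a => ?_⟩, fun a => (h2 a).symm⟩
    · have := h1 a b hab
      rw [inf_comm, h, bot_sup_eq] at this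
      exact this.symm
    · simp only [h2, key']
  · rintro ⟨⟨h1, -⟩, h2⟩
    refine ⟨fun a b hab => (h1 _ _ (sup_le inf_le_left hab) ?_).symm, fun a => (h2 a).symm⟩
    have h0 : ∀ c : A, c ⊓ kl c = ⊥ := fun c => by rw [h2, inf_br]
    rw [key, inf_assoc, inf_comm (kl a), inf_comm, h0]

end BZLat

/-! The lattice reduct supplies the median term, so congruences distribute. Let `E` be a subalgebra
of a product with factors in two varieties, and let `r`, `s` be the kernels of its projections to
the factors from each. They meet trivially, so any congruence `θ` of `E` equals `(θ ∨ r) ∧ (θ ∨ s)`: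
every quotient of `E` is again subdirect, which gives join = subdirect product
(`join_subset_subdirectProduct`). Distributivity also shows that joining with a fixed variety
commutes with intersections (`join_inter_join_subset`).

Two representations identify the distributive part. A prime filter of a distributive algebra with
strong De Morgan yields four nested prime filters, that is, a homomorphism into `D₅`; hence `V(D₅) =
SAOL ∩ DIST`. Localizing a distributive PBZ*-lattice at its complemented elements yields
antiortholattices; hence `DIST ⊆ V(AOL)`.

Strictness comes from identities in the terms `x ∧ x'`. These terms vanish in orthomodular lattices,
so the orthomodular factor satisfies the identities for free. Apart from `D₅`, the counterexamples
are ordinal sums of a lattice `M` with its dual, where the values of `x ∧ x'` are exactly the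
elements of `M`. -/

namespace BZHom

/-! ### Homomorphisms and factorization. -/

variable {L M N : Type*} [BZLattice L] [BZLattice M] [BZLattice N]

instance : CoeFun (BZHom L M) fun _ => L → M := ⟨fun f => f.toFun⟩

theorem map_inf (f : BZHom L M) (a b : L) : f (a ⊓ b) = f a ⊓ f b := f.map_inf' a b

theorem map_sup (f : BZHom L M) (a b : L) : f (a ⊔ b) = f a ⊔ f b := f.map_sup' a b

theorem map_bot (f : BZHom L M) : f ⊥ = ⊥ := f.map_bot'

theorem map_top (f : BZHom L M) : f ⊤ = ⊤ := f.map_top'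

/-- The homomorphism with a given underlying map. -/
def ofFun (f : L → M) (hinf : ∀ a b, f (a ⊓ b) = f a ⊓ f b) (hsup : ∀ a b, f (a ⊔ b) = f a ⊔ f b)
    (hbot : f ⊥ = ⊥) (htop : f ⊤ = ⊤) (hkl : ∀ a, f (BZLattice.kl a) = BZLattice.kl (f a))
    (hbr : ∀ a, f (BZLattice.br a) = BZLattice.br (f a)) : BZHom L M where
  toFun := f
  map_sup' := hsup
  map_inf' := hinf
  map_top' := htop
  map_bot' := hbot
  map_kl := hkl
  map_br := hbr

/-- The identity homomorphism. -/
def id (L : Type*) [BZLattice L] : BZHom L L :=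
  ofFun (fun a => a) (fun _ _ => rfl) (fun _ _ => rfl) rfl rfl (fun _ => rfl) (fun _ => rfl)

/-- Composition of homomorphisms. -/
def comp (g : BZHom M N) (f : BZHom L M) : BZHom L N :=
  ofFun (fun a => g (f a)) (fun a b => by rw [f.map_inf, g.map_inf])
    (fun a b => by rw [f.map_sup, g.map_sup]) (by rw [f.map_bot, g.map_bot])
    (by rw [f.map_top, g.map_top]) (fun a => by rw [f.map_kl, g.map_kl])
    (fun a => by rw [f.map_br, g.map_br])

@[simp] theorem comp_apply (g : BZHom M N) (f : BZHom L M) (a : L) : g.comp f a = g (f a) := rfl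

/-- The first projection of a binary product. -/
def fst (L M : Type*) [BZLattice L] [BZLattice M] : BZHom (L × M) L :=
  ofFun Prod.fst (fun _ _ => rfl) (fun _ _ => rfl) rfl rfl (fun _ => rfl) (fun _ => rfl)

/-- The second projection of a binary product. -/
def snd (L M : Type*) [BZLattice L] [BZLattice M] : BZHom (L × M) M :=
  ofFun Prod.snd (fun _ _ => rfl) (fun _ _ => rfl) rfl rfl (fun _ => rfl) (fun _ => rfl)

/-- The homomorphism into a binary product with given components. -/
def prod (f : BZHom L M) (g : BZHom L N) : BZHom L (M × N) :=
  ofFun (fun a => (f a, g a)) (fun a b => Prod.ext (f.map_inf a b) (g.map_inf a b))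
    (fun a b => Prod.ext (f.map_sup a b) (g.map_sup a b)) (Prod.ext f.map_bot g.map_bot)
    (Prod.ext f.map_top g.map_top) (fun a => Prod.ext (f.map_kl a) (g.map_kl a))
    (fun a => Prod.ext (f.map_br a) (g.map_br a))

/-- A projection of a direct product. -/
def proj {I : Type*} (B : I → Type*) [∀ i, BZLattice (B i)] (i : I) : BZHom (∀ i, B i) (B i) :=
  ofFun (fun a => a i) (fun _ _ => rfl) (fun _ _ => rfl) rfl rfl (fun _ => rfl) (fun _ => rfl)

@[simp] theorem proj_apply {I : Type*} (B : I → Type*) [∀ i, BZLattice (B i)] (i : I)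
    (a : ∀ i, B i) : proj B i a = a i := rfl

/-- The homomorphism into a direct product with given components. -/
def pi {I : Type*} {B : I → Type*} [∀ i, BZLattice (B i)] (f : ∀ i, BZHom L (B i)) :
    BZHom L (∀ i, B i) :=
  ofFun (fun a i => f i a) (fun a b => funext fun i => (f i).map_inf a b)
    (fun a b => funext fun i => (f i).map_sup a b) (funext fun i => (f i).map_bot)
    (funext fun i => (f i).map_top) (fun a => funext fun i => (f i).map_kl a)
    (fun a => funext fun i => (f i).map_br a)

/-- The section `s` need not be a homomorphism: `g ∘ s` is one, because `g` is constant on the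
fibres of `f`. -/
theorem exists_lift (f : BZHom L M) (hf : Function.Surjective f) (g : BZHom L N)
    (h : ∀ a b, f a = f b → g a = g b) : ∃ k : BZHom M N, ∀ a, k (f a) = g a := by
  choose s hs using hf
  have key : ∀ a, g (s (f a)) = g a := fun a => h _ _ (hs _)
  have hk : ∀ (x : M) (a : L), f a = x → g (s x) = g a := by rintro _ a rfl; exact key a
  refine ⟨ofFun (fun x => g (s x)) (fun x y => ?_) (fun x y => ?_) ?_ ?_ (fun x => ?_)
    (fun x => ?_), key⟩
  · rw [hk _ (s x ⊓ s y) (by rw [f.map_inf, hs, hs]), g.map_inf]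
  · rw [hk _ (s x ⊔ s y) (by rw [f.map_sup, hs, hs]), g.map_sup]
  · rw [hk _ ⊥ f.map_bot, g.map_bot]
  · rw [hk _ ⊤ f.map_top, g.map_top]
  · rw [hk _ (BZLattice.kl (s x)) (by rw [f.map_kl, hs]), g.map_kl]
  · rw [hk _ (BZLattice.br (s x)) (by rw [f.map_br, hs]), g.map_br]

end BZHom

/-! ### De Morgan laws, congruences and congruence distributivity. -/

namespace BZLattice

variable {L : Type*} [BZLattice L]

theorem kl_sup (a b : L) : kl (a ⊔ b) = kl a ⊓ kl b := by
  apply le_antisymm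
  · exact le_inf (kl_anti _ _ le_sup_left) (kl_anti _ _ le_sup_right)
  · rw [← kl_kl (kl a ⊓ kl b)]
    refine kl_anti _ _ (sup_le ?_ ?_)
    · conv_lhs => rw [← kl_kl a]
      exact kl_anti _ _ inf_le_left
    · conv_lhs => rw [← kl_kl b]
      exact kl_anti _ _ inf_le_right

theorem kl_inf (a b : L) : kl (a ⊓ b) = kl a ⊔ kl b := by
  rw [← kl_kl (kl a ⊔ kl b), kl_sup, kl_kl, kl_kl]

theorem kl_top : kl (⊤ : L) = ⊥ := by
  refine le_bot_iff.mp ?_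
  conv_rhs => rw [← kl_kl ⊥]
  exact kl_anti _ _ le_top

theorem kl_bot : kl (⊥ : L) = ⊤ := by rw [← kl_top, kl_kl]

theorem br_top : br (⊤ : L) = ⊥ := by simpa using inf_br (⊤ : L)

theorem br_bot : br (⊥ : L) = ⊤ := by
  refine top_le_iff.mp ?_
  rw [← br_top]
  exact le_br_br _

/-- The Brouwer complement forms an antitone Galois connection with itself, so it turns joins into
meets. The dual law is the strong De Morgan identity, which is not automatic. -/
theorem br_sup (a b : L) : br (a ⊔ b) = br a ⊓ br b := by
  apply le_antisymm
  · exact le_inf (br_anti _ _ le_sup_left) (br_anti _ _ le_sup_right)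
  · exact (le_br_br _).trans (br_anti _ _ (sup_le ((le_br_br a).trans (br_anti _ _ inf_le_left))
      ((le_br_br b).trans (br_anti _ _ inf_le_right))))

theorem br_br_br (a : L) : br (br (br a)) = br a :=
  le_antisymm (br_anti _ _ (le_br_br a)) (le_br_br _)

theorem br_le_kl (a : L) : br a ≤ kl a := by
  rw [← kl_kl (br a), ← br_br]
  exact kl_anti _ _ (le_br_br a)

/-- A congruence: an equivalence relation compatible with the operations. -/
structure IsCong (r : Setoid L) : Prop where
  inf : ∀ {a b c d}, r a b → r c d → r (a ⊓ c) (b ⊓ d)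
  sup : ∀ {a b c d}, r a b → r c d → r (a ⊔ c) (b ⊔ d)
  kl : ∀ {a b}, r a b → r (kl a) (kl b)
  br : ∀ {a b}, r a b → r (br a) (br b)

theorem isCong_ker {M : Type*} [BZLattice M] (f : BZHom L M) : IsCong (Setoid.ker f.toFun) where
  inf {a b c d} h k := by
    have h : f a = f b := h
    have k : f c = f d := k
    change f _ = f _
    rw [f.map_inf, f.map_inf, h, k]
  sup {a b c d} h k := by
    have h : f a = f b := h
    have k : f c = f d := k
    change f _ = f _
    rw [f.map_sup, f.map_sup, h, k]
  kl {a b} h := by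
    have h : f a = f b := h
    change f _ = f _
    rw [f.map_kl, f.map_kl, h]
  br {a b} h := by
    have h : f a = f b := h
    change f _ = f _
    rw [f.map_br, f.map_br, h]

theorem IsCong.inf_setoid {r s : Setoid L} (hr : IsCong r) (hs : IsCong s) : IsCong (r ⊓ s) where
  inf h k := ⟨hr.inf h.1 k.1, hs.inf h.2 k.2⟩
  sup h k := ⟨hr.sup h.1 k.1, hs.sup h.2 k.2⟩
  kl h := ⟨hr.kl h.1, hs.kl h.2⟩
  br h := ⟨hr.br h.1, hs.br h.2⟩

/-- Induction along the steps of the join of two equivalence relations. -/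
theorem setoid_sup_le {α : Type*} {r s : Setoid α} {p : α → α → Prop} (hrefl : ∀ a, p a a)
    (hsymm : ∀ a b, p a b → p b a) (htrans : ∀ a b c, p a b → p b c → p a c)
    (hr : ∀ a b, r a b → p a b) (hs : ∀ a b, s a b → p a b) {a b : α} (h : (r ⊔ s) a b) : p a b :=
  (sup_le (c := (⟨p, hrefl, hsymm _ _, htrans _ _ _⟩ : Setoid α)) (fun {_ _} => hr _ _)
    (fun {_ _} => hs _ _) : r ⊔ s ≤ _) h

theorem sup_unary {α : Type*} {r s : Setoid α} (f : α → α) (hr : ∀ a b, r a b → r (f a) (f b))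
    (hs : ∀ a b, s a b → s (f a) (f b)) {a b : α} (h : (r ⊔ s) a b) : (r ⊔ s) (f a) (f b) :=
  setoid_sup_le (p := fun a b => (r ⊔ s) (f a) (f b)) (fun _ => (r ⊔ s).refl _)
    (fun _ _ => (r ⊔ s).symm) (fun _ _ _ => (r ⊔ s).trans)
    (fun a b h => (le_sup_left : r ≤ r ⊔ s) (hr a b h))
    (fun a b h => (le_sup_right : s ≤ r ⊔ s) (hs a b h)) h

/-- Binary operations are handled one argument at a time, so that each change is a unary map
compatible with both relations. -/
theorem IsCong.sup_setoid {r s : Setoid L} (hr : IsCong r) (hs : IsCong s) : IsCong (r ⊔ s) where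
  inf {_ b c _} h k := (r ⊔ s).trans
    (sup_unary (· ⊓ c) (fun _ _ h => hr.inf h (r.refl _)) (fun _ _ h => hs.inf h (s.refl _)) h)
    (sup_unary (b ⊓ ·) (fun _ _ h => hr.inf (r.refl _) h) (fun _ _ h => hs.inf (s.refl _) h) k)
  sup {_ b c _} h k := (r ⊔ s).trans
    (sup_unary (· ⊔ c) (fun _ _ h => hr.sup h (r.refl _)) (fun _ _ h => hs.sup h (s.refl _)) h)
    (sup_unary (b ⊔ ·) (fun _ _ h => hr.sup (r.refl _) h) (fun _ _ h => hs.sup (s.refl _) h) k)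
  kl h := sup_unary BZLattice.kl (fun _ _ h => hr.kl h) (fun _ _ h => hs.kl h) h
  br h := sup_unary BZLattice.br (fun _ _ h => hr.br h) (fun _ _ h => hs.br h) h

/-- The median term. -/
def med (a b c : L) : L := (a ⊓ b) ⊔ (b ⊓ c) ⊔ (a ⊓ c)

theorem med_outer (a b : L) : med a b a = a := by
  refine le_antisymm (sup_le (sup_le inf_le_left inf_le_right) inf_le_left) ?_
  exact (le_inf le_rfl le_rfl).trans le_sup_right

theorem med_left (a b : L) : med a a b = a := by
  refine le_antisymm (sup_le (sup_le inf_le_left inf_le_left) inf_le_left) ?_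
  exact (le_inf le_rfl le_rfl).trans (le_sup_left.trans le_sup_left)

theorem med_right (a b : L) : med a b b = b := by
  refine le_antisymm (sup_le (sup_le inf_le_right inf_le_right) inf_le_right) ?_
  exact (le_inf le_rfl le_rfl).trans (le_sup_right.trans le_sup_left)

theorem IsCong.med {r : Setoid L} (hr : IsCong r) {a b c a' b' c' : L} (ha : r a a') (hb : r b b')
    (hc : r c c') : r (med a b c) (med a' b' c') :=
  hr.sup (hr.sup (hr.inf ha hb) (hr.inf hb hc)) (hr.inf ha hc)

/-- Congruence distributivity. -/
theorem IsCong.inf_sup_le {p r s : Setoid L} (hp : IsCong p) (hr : IsCong r) (hs : IsCong s) :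
    p ⊓ (r ⊔ s) ≤ (p ⊓ r) ⊔ (p ⊓ s) := by
  rintro a b ⟨h, k⟩
  -- Since `p` relates `a` and `b`, `med a z b` is `p`-related to `med a z a = a` for every `z`.
  have hmed : ∀ x y, p (BZLattice.med a x b) (BZLattice.med a y b) := fun x y => by
    have key : ∀ z, p (BZLattice.med a z b) a := fun z => by
      have := hp.med (p.refl a) (p.refl z) (p.symm h)
      rwa [med_outer] at this
    exact p.trans (key x) (p.symm (key y))
  -- Applying `med a · b` to a chain from `a` to `b` keeps the endpoints and puts every step inside
  -- `p`.
  have := setoid_sup_le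
    (p := fun x y => ((p ⊓ r) ⊔ (p ⊓ s)) (BZLattice.med a x b) (BZLattice.med a y b))
    (fun _ => Setoid.refl' _ _) (fun _ _ => Setoid.symm' _) (fun _ _ _ => Setoid.trans' _)
    (fun x y h => (le_sup_left : p ⊓ r ≤ _) ⟨hmed x y, hr.med (r.refl a) h (r.refl b)⟩)
    (fun x y h => (le_sup_right : p ⊓ s ≤ _) ⟨hmed x y, hs.med (s.refl a) h (s.refl b)⟩) k
  rwa [med_left, med_right] at this

/-- The dual distributive law. It transfers a subdirect decomposition from an algebra to its
quotient by `p`. -/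
theorem IsCong.sup_inf_sup_le {p r s : Setoid L} (hp : IsCong p) (hr : IsCong r) (hs : IsCong s)
    (h : r ⊓ s ≤ p) : (p ⊔ r) ⊓ (p ⊔ s) ≤ p := by
  refine ((hp.sup_setoid hr).inf_sup_le hp hs).trans (sup_le inf_le_right ?_)
  rw [inf_comm]
  refine (hs.inf_sup_le hp hr).trans (sup_le inf_le_right ?_)
  rwa [inf_comm]

/-- The quotient by a congruence. -/
abbrev quotient {r : Setoid L} (hr : IsCong r) : BZLattice (Quotient r) :=
  letI : Max (Quotient r) := ⟨Quotient.map₂ (· ⊔ ·) fun _ _ h _ _ k => hr.sup h k⟩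
  letI : Min (Quotient r) := ⟨Quotient.map₂ (· ⊓ ·) fun _ _ h _ _ k => hr.inf h k⟩
  have mk_sup : ∀ a b : L, (Quotient.mk r a ⊔ Quotient.mk r b) = Quotient.mk r (a ⊔ b) :=
    fun _ _ => rfl
  have mk_inf : ∀ a b : L, (Quotient.mk r a ⊓ Quotient.mk r b) = Quotient.mk r (a ⊓ b) :=
    fun _ _ => rfl
  letI inst : Lattice (Quotient r) := Lattice.mk'
    (by rintro ⟨a⟩ ⟨b⟩; exact congrArg (Quotient.mk r) (sup_comm a b))
    (by rintro ⟨a⟩ ⟨b⟩ ⟨c⟩; exact congrArg (Quotient.mk r) (sup_assoc a b c))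
    (by rintro ⟨a⟩ ⟨b⟩; exact congrArg (Quotient.mk r) (inf_comm a b))
    (by rintro ⟨a⟩ ⟨b⟩ ⟨c⟩; exact congrArg (Quotient.mk r) (inf_assoc a b c))
    (by rintro ⟨a⟩ ⟨b⟩; exact congrArg (Quotient.mk r) sup_inf_self)
    (by rintro ⟨a⟩ ⟨b⟩; exact congrArg (Quotient.mk r) inf_sup_self)
  letI : LE (Quotient r) := inst.toPartialOrder.toLE
  have mono : ∀ {a b : L}, a ≤ b → Quotient.mk r a ≤ Quotient.mk r b := fun {a b} h =>
    inf_eq_left.mp ((mk_inf a b).trans (congrArg (Quotient.mk r) (inf_eq_left.mpr h)))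
  -- An inequality of classes lifts to representatives after replacing `a` by `a ⊓ b`; this is how
  -- the antitone laws descend.
  have rep : ∀ x y : Quotient r, x ≤ y → ∃ a b : L, a ≤ b ∧ x = Quotient.mk r a ∧
      y = Quotient.mk r b := by
    rintro ⟨a⟩ ⟨b⟩ h
    exact ⟨a ⊓ b, b, inf_le_right, (inf_eq_left (α := Quotient r).mpr h).symm, rfl⟩
  { top := Quotient.mk r ⊤
    bot := Quotient.mk r ⊥
    le_top := by rintro ⟨a⟩; exact mono le_top
    bot_le := by rintro ⟨a⟩; exact mono bot_le
    kl := Quotient.map kl fun _ _ h => hr.kl h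
    br := Quotient.map br fun _ _ h => hr.br h
    kl_anti := by
      intro x y h
      obtain ⟨a, b, hab, rfl, rfl⟩ := rep x y h
      exact mono (kl_anti _ _ hab)
    kl_kl := by rintro ⟨a⟩; exact congrArg (Quotient.mk r) (kl_kl a)
    inf_kl_le_sup_kl := by rintro ⟨a⟩ ⟨b⟩; exact mono (inf_kl_le_sup_kl a b)
    br_anti := by
      intro x y h
      obtain ⟨a, b, hab, rfl, rfl⟩ := rep x y h
      exact mono (br_anti _ _ hab)
    inf_br := by rintro ⟨a⟩; exact congrArg (Quotient.mk r) (inf_br a)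
    le_br_br := by rintro ⟨a⟩; exact mono (le_br_br a)
    br_br := by rintro ⟨a⟩; exact congrArg (Quotient.mk r) (br_br a) }

/-- The equalizer of two homomorphisms. -/
abbrev equalizer {M : Type*} [BZLattice M] (f g : BZHom L M) :
    BZLattice {a : L // f a = g a} :=
  letI : Lattice {a : L // f a = g a} := Subtype.lattice
    (fun {a b} ha hb => by rw [f.map_sup, g.map_sup, ha, hb])
    (fun {a b} ha hb => by rw [f.map_inf, g.map_inf, ha, hb])
  { top := ⟨⊤, by rw [f.map_top, g.map_top]⟩
    bot := ⟨⊥, by rw [f.map_bot, g.map_bot]⟩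
    le_top := fun a => (le_top : a.1 ≤ ⊤)
    bot_le := fun a => (bot_le : ⊥ ≤ a.1)
    kl := fun a => ⟨kl a.1, by rw [f.map_kl, g.map_kl, a.2]⟩
    br := fun a => ⟨br a.1, by rw [f.map_br, g.map_br, a.2]⟩
    kl_anti := fun _ _ h => kl_anti _ _ h
    kl_kl := fun _ => Subtype.ext (kl_kl _)
    inf_kl_le_sup_kl := fun a b => inf_kl_le_sup_kl a.1 b.1
    br_anti := fun _ _ h => br_anti _ _ h
    inf_br := fun _ => Subtype.ext (inf_br _)
    le_br_br := fun a => le_br_br a.1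
    br_br := fun _ => Subtype.ext (br_br _) }

end BZLattice

/-! ### Quotient algebras, pullbacks and generated varieties. -/

namespace BZLat

open BZLattice

/-- The quotient algebra by a congruence. -/
def quot {A : BZLat.{u}} {r : Setoid A} (hr : IsCong r) : BZLat.{u} :=
  @BZLat.mk (Quotient r) (BZLattice.quotient hr)

/-- The canonical projection onto a quotient. -/
def quotMk {A : BZLat.{u}} {r : Setoid A} (hr : IsCong r) : BZHom A (quot hr) :=
  letI := BZLattice.quotient hr
  (BZHom.ofFun (Quotient.mk r) (fun _ _ => rfl) (fun _ _ => rfl) rfl rfl (fun _ => rfl)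
    (fun _ => rfl) : BZHom A (Quotient r))

theorem quotMk_surjective {A : BZLat.{u}} {r : Setoid A} (hr : IsCong r) :
    Function.Surjective (quotMk hr) := Quotient.mk_surjective

theorem quotMk_eq {A : BZLat.{u}} {r : Setoid A} (hr : IsCong r) {a b : A} :
    quotMk hr a = quotMk hr b ↔ r a b := Quotient.eq

/-- The pullback of two homomorphisms exists. -/
theorem exists_pullback {A B D : BZLat.{u}} (f : BZHom A D) (g : BZHom B D) :
    ∃ (E : BZLat.{u}) (p : BZHom E A) (q : BZHom E B), (∀ e, f (p e) = g (q e)) ∧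
      (∀ e e', p e = p e' → q e = q e' → e = e') ∧ ∀ a b, f a = g b → ∃ e, p e = a ∧ q e = b := by
  let _ := equalizer (f.comp (BZHom.fst A B)) (g.comp (BZHom.snd A B))
  let i : BZHom {x : A × B // f.comp (BZHom.fst A B) x = g.comp (BZHom.snd A B) x} (A × B) :=
    BZHom.ofFun Subtype.val (fun _ _ => rfl) (fun _ _ => rfl) rfl rfl (fun _ => rfl) (fun _ => rfl)
  refine ⟨⟨{x : A × B // f.comp (BZHom.fst A B) x = g.comp (BZHom.snd A B) x}⟩,
    (BZHom.fst A B).comp i, (BZHom.snd A B).comp i, fun e => e.2, ?_, ?_⟩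
  · rintro ⟨⟨a, b⟩, _⟩ ⟨⟨c, d⟩, _⟩ (h : a = c) (k : b = d)
    subst h k
    rfl
  · exact fun a b h => ⟨⟨(a, b), h⟩, rfl, rfl⟩

/-! ### Varieties -/

theorem mem_V_iff {C : Set BZLat.{u}} {A : BZLat.{u}} : A ∈ V C ↔
    ∃ (I : Type u) (B : I → BZLat.{u}) (D : BZLat.{u}) (g : BZHom D (∀ i, B i)) (f : BZHom D A),
      (∀ i, B i ∈ C) ∧ Function.Injective g ∧ Function.Surjective f := by
  constructor
  · rintro ⟨D, ⟨E, ⟨I, B, hB, k, hk⟩, g, hg⟩, f, hf⟩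
    exact ⟨I, B, D, k.comp g, f, hB, hk.1.comp hg, hf⟩
  · rintro ⟨I, B, D, g, f, hB, hg, hf⟩
    exact ⟨D, ⟨⟨∀ i, B i⟩, ⟨I, B, hB, BZHom.id _, Function.bijective_id⟩, g, hg⟩, f, hf⟩

theorem V_mono {C D : Set BZLat.{u}} (h : C ⊆ D) : V C ⊆ V D := by
  intro A hA
  obtain ⟨I, B, D, g, f, hB, hg, hf⟩ := mem_V_iff.mp hA
  exact mem_V_iff.mpr ⟨I, B, D, g, f, fun i => h (hB i), hg, hf⟩

theorem mem_V_of_surjective {C : Set BZLat.{u}} {A A' : BZLat.{u}} (hA : A ∈ V C)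
    (k : BZHom A A') (hk : Function.Surjective k) : A' ∈ V C := by
  obtain ⟨I, B, D, g, f, hB, hg, hf⟩ := mem_V_iff.mp hA
  exact mem_V_iff.mpr ⟨I, B, D, g, k.comp f, hB, hg, hk.comp hf⟩

/-- The inclusion SH ⊆ HS: the subalgebra is pulled back along the surjection. -/
theorem mem_V_of_injective {C : Set BZLat.{u}} {A A' : BZLat.{u}} (hA : A ∈ V C)
    (k : BZHom A' A) (hk : Function.Injective k) : A' ∈ V C := by
  obtain ⟨I, B, D, g, f, hB, hg, hf⟩ := mem_V_iff.mp hA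
  obtain ⟨E, p, q, hpq, hinj, hsurj⟩ := exists_pullback f k
  refine mem_V_iff.mpr ⟨I, B, E, g.comp p, q, hB, fun e e' h => ?_, fun a => ?_⟩
  · have h : p e = p e' := hg h
    exact hinj e e' h (hk (by rw [← hpq, ← hpq, h]))
  · obtain ⟨d, hd⟩ := hf (k a)
    obtain ⟨e, -, he⟩ := hsurj d a hd
    exact ⟨e, he⟩

/-- Products commute past H and S, and a product of products is a product over the sigma type of
indices. -/
theorem pi_mem_V {C : Set BZLat.{u}} {I : Type u} {A : I → BZLat.{u}} (hA : ∀ i, A i ∈ V C) :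
    (⟨∀ i, A i⟩ : BZLat.{u}) ∈ V C := by
  choose J B D g f hB hg hf using fun i => mem_V_iff.mp (hA i)
  refine mem_V_iff.mpr ⟨(i : I) × J i, fun x => B x.1 x.2, ⟨∀ i, D i⟩,
    BZHom.pi fun x => (BZHom.proj (fun j => B x.1 j) x.2).comp
      ((g x.1).comp (BZHom.proj (fun i => D i) x.1)),
    BZHom.pi fun i => (f i).comp (BZHom.proj (fun i => D i) i), fun x => hB x.1 x.2, ?_, ?_⟩
  · exact fun a b h => funext fun i => hg i (funext fun j => congrFun h ⟨i, j⟩)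
  · intro a
    choose d hd using fun i => hf i (a i)
    exact ⟨d, funext hd⟩

theorem V_V (C : Set BZLat.{u}) : V (V C) ⊆ V C := by
  intro A hA
  obtain ⟨I, B, D, g, f, hB, hg, hf⟩ := mem_V_iff.mp hA
  exact mem_V_of_surjective (mem_V_of_injective (pi_mem_V hB) g hg) f hf

/-- An algebra whose points are separated by homomorphisms into `C` is in the variety generated
by `C`. -/
theorem mem_V_of_separating {C : Set BZLat.{u}} {A : BZLat.{u}}
    (h : ∀ a b : A, a ≠ b → ∃ B ∈ C, ∃ f : BZHom A B, f a ≠ f b) : A ∈ V C := by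
  choose B hB f hf using h
  refine mem_V_iff.mpr ⟨{x : A × A // x.1 ≠ x.2}, fun x => B x.1.1 x.1.2 x.2, A,
    BZHom.pi fun x => f x.1.1 x.1.2 x.2, BZHom.id A, fun x => hB _ _ _, fun a b hab => ?_,
    Function.surjective_id⟩
  by_contra hne
  exact hf a b hne (congrFun hab ⟨(a, b), hne⟩)

theorem subset_V (C : Set BZLat.{u}) : C ⊆ V C :=
  fun A hA => mem_V_of_separating fun _ _ h => ⟨A, hA, BZHom.id A, h⟩

/-- A class closed under homomorphic images, subalgebras and direct products. -/
def IsVariety (K : Set BZLat.{u}) : Prop := V K ⊆ K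

theorem isVariety_V (C : Set BZLat.{u}) : IsVariety (V C) := V_V C

theorem IsVariety.inter {K K' : Set BZLat.{u}} (h : IsVariety K) (h' : IsVariety K') :
    IsVariety (K ∩ K') :=
  fun _ hA => ⟨h (V_mono Set.inter_subset_left hA), h' (V_mono Set.inter_subset_right hA)⟩

theorem IsVariety.V_subset {C K : Set BZLat.{u}} (h : IsVariety K) (hC : C ⊆ K) : V C ⊆ K :=
  (V_mono hC).trans h

theorem IsVariety.surjective {K : Set BZLat.{u}} (h : IsVariety K) {A B : BZLat.{u}} (hA : A ∈ K)
    (f : BZHom A B) (hf : Function.Surjective f) : B ∈ K :=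
  h (mem_V_of_surjective (subset_V K hA) f hf)

theorem subset_join_left (C D : Set BZLat.{u}) : C ⊆ join C D :=
  Set.subset_union_left.trans (subset_V _)

theorem subset_join_right (C D : Set BZLat.{u}) : D ⊆ join C D :=
  Set.subset_union_right.trans (subset_V _)

theorem join_subset {C D K : Set BZLat.{u}} (h : IsVariety K) (hC : C ⊆ K) (hD : D ⊆ K) :
    join C D ⊆ K := h.V_subset (Set.union_subset hC hD)

theorem isVariety_join (C D : Set BZLat.{u}) : IsVariety (join C D) := isVariety_V _

theorem join_mono {C D D' : Set BZLat.{u}} (h : D ⊆ D') : join C D ⊆ join C D' :=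
  V_mono (Set.union_subset_union_right C h)

theorem subdirectProduct_subset_join (C D : Set BZLat.{u}) : subdirectProduct C D ⊆ join C D := by
  rintro A ⟨B, hB, B', hB', f, hf, -⟩
  refine mem_V_of_separating fun a b hab => ?_
  by_cases h : (f a).1 = (f b).1
  · exact ⟨B', Or.inr hB', (BZHom.snd B B').comp f, fun h' => hab (hf (Prod.ext h h'))⟩
  · exact ⟨B, Or.inl hB, (BZHom.fst B B').comp f, h⟩

/-- By congruence distributivity, the join of two varieties consists of subdirect products. -/
theorem join_subset_subdirectProduct {C D : Set BZLat.{u}} (hC : IsVariety C) (hD : IsVariety D) :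
    join C D ⊆ subdirectProduct C D := by
  intro A hA
  obtain ⟨I, B, E, g, f, hB, hg, hf⟩ := mem_V_iff.mp hA
  -- The relation `r` is the kernel of the projection to the coordinates with factor in `K`, so `E /
  -- r` and all its quotients lie in `K`.
  have key : ∀ {K : Set BZLat.{u}}, IsVariety K → ∃ r : Setoid E, IsCong r ∧
      (∀ a b, r a b → ∀ i, B i ∈ K → g a i = g b i) ∧
      ∀ s : Setoid E, (hs : IsCong s) → r ≤ s → quot hs ∈ K := by
    intro K hK
    let φ : BZHom E (∀ i : {i // B i ∈ K}, B i) :=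
      BZHom.pi fun i => (BZHom.proj (fun i => B i) i.1).comp g
    refine ⟨Setoid.ker φ.toFun, isCong_ker φ, fun a b h i hi => congrFun h ⟨i, hi⟩, ?_⟩
    intro s hs hle
    have hq : quot (isCong_ker φ) ∈ K := by
      refine hK (mem_V_of_separating fun x y hxy => ?_)
      obtain ⟨a, rfl⟩ := quotMk_surjective _ x
      obtain ⟨b, rfl⟩ := quotMk_surjective _ y
      have : ∃ i, φ a i ≠ φ b i := by
        by_contra! h
        exact hxy ((quotMk_eq _).mpr (funext h))
      obtain ⟨i, hi⟩ := this
      obtain ⟨k, hk⟩ := BZHom.exists_lift (quotMk (isCong_ker φ)) (quotMk_surjective _)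
        ((BZHom.proj (fun i : {i // B i ∈ K} => B i) i).comp φ)
        fun a b h => congrFun ((quotMk_eq _).mp h) i
      exact ⟨B i, i.2, k, by rw [hk, hk]; exact hi⟩
    obtain ⟨k, hk⟩ := BZHom.exists_lift (quotMk (isCong_ker φ)) (quotMk_surjective _) (quotMk hs)
      fun a b h => (quotMk_eq hs).mpr (hle ((quotMk_eq _).mp h))
    refine hK.surjective hq k fun y => ?_
    obtain ⟨a, rfl⟩ := quotMk_surjective hs y
    exact ⟨_, hk a⟩
  obtain ⟨r, hr, hr1, hr2⟩ := key hC
  obtain ⟨s, hs, hs1, hs2⟩ := key hD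
  -- Every coordinate belongs to `C` or `D`, so the two kernels intersect in equality.
  have hrs : r ⊓ s ≤ Setoid.ker f.toFun := by
    rintro a b ⟨h, k⟩
    have : a = b := hg (funext fun i => (hB i).elim (hr1 a b h i) (hs1 a b k i))
    exact congrArg f.toFun this
  have hθ := isCong_ker f
  obtain ⟨p, hp⟩ := BZHom.exists_lift f hf (quotMk (hθ.sup_setoid hr))
    fun a b h => (quotMk_eq _).mpr ((le_sup_left : Setoid.ker f.toFun ≤ _) h)
  obtain ⟨q, hq⟩ := BZHom.exists_lift f hf (quotMk (hθ.sup_setoid hs))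
    fun a b h => (quotMk_eq _).mpr ((le_sup_left : Setoid.ker f.toFun ≤ _) h)
  refine ⟨_, hr2 _ (hθ.sup_setoid hr) le_sup_right, _, hs2 _ (hθ.sup_setoid hs) le_sup_right,
    p.prod q, ?_, ?_, ?_⟩
  · intro x y h
    obtain ⟨a, rfl⟩ := hf x
    obtain ⟨b, rfl⟩ := hf y
    have h1 : p (f a) = p (f b) := congrArg Prod.fst h
    have h2 : q (f a) = q (f b) := congrArg Prod.snd h
    rw [hp, hp, quotMk_eq] at h1
    rw [hq, hq, quotMk_eq] at h2
    exact hθ.sup_inf_sup_le hr hs hrs ⟨h1, h2⟩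
  · intro y
    obtain ⟨a, rfl⟩ := quotMk_surjective _ y
    exact ⟨f a, hp a⟩
  · intro y
    obtain ⟨a, rfl⟩ := quotMk_surjective _ y
    exact ⟨f a, hq a⟩

theorem join_eq_subdirectProduct {C D : Set BZLat.{u}} (hC : IsVariety C) (hD : IsVariety D) :
    join C D = subdirectProduct C D :=
  (join_subset_subdirectProduct hC hD).antisymm (subdirectProduct_subset_join C D)

/-- Joins with a fixed variety distribute over the intersection of varieties. -/
theorem join_inter_join_subset {C D D' : Set BZLat.{u}} (hC : IsVariety C) (hD : IsVariety D)
    (hD' : IsVariety D') : join C D ∩ join C D' ⊆ join C (D ∩ D') := by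
  rintro A ⟨h, h'⟩
  obtain ⟨X, hX, Y, hY, f, hf, -, hf2⟩ := join_subset_subdirectProduct hC hD h
  obtain ⟨X', hX', Y', hY', f', hf', -, hf2'⟩ := join_subset_subdirectProduct hC hD' h'
  let p := (BZHom.fst X Y).comp f
  let q := (BZHom.snd X Y).comp f
  let p' := (BZHom.fst X' Y').comp f'
  let q' := (BZHom.snd X' Y').comp f'
  have hp := isCong_ker p
  have hq := isCong_ker q
  have hp' := isCong_ker p'
  have hq' := isCong_ker q'
  -- The quotient by `ker q ∨ ker q'` is an image of both `Y` and `Y'`, hence lies in `D ∩ D'`.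
  have hT := hq.sup_setoid hq'
  have hTD : quot hT ∈ D := by
    obtain ⟨k, hk⟩ := BZHom.exists_lift q hf2 (quotMk hT)
      fun a b h => (quotMk_eq _).mpr ((le_sup_left : Setoid.ker q.toFun ≤ _) h)
    refine hD.surjective hY k fun y => ?_
    obtain ⟨a, rfl⟩ := quotMk_surjective hT y
    exact ⟨_, hk a⟩
  have hTD' : quot hT ∈ D' := by
    obtain ⟨k, hk⟩ := BZHom.exists_lift q' hf2' (quotMk hT)
      fun a b h => (quotMk_eq _).mpr ((le_sup_right : Setoid.ker q'.toFun ≤ _) h)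
    refine hD'.surjective hY' k fun y => ?_
    obtain ⟨a, rfl⟩ := quotMk_surjective hT y
    exact ⟨_, hk a⟩
  refine mem_V_of_separating fun a b hab => ?_
  by_cases h1 : p a = p b
  · by_cases h2 : p' a = p' b
    · refine ⟨quot hT, Or.inr ⟨hTD, hTD'⟩, quotMk hT, fun h3 => hab ?_⟩
      -- Distributivity splits the relation into steps in `ker p ∧ ker q` or in `ker p' ∧ ker q'`,
      -- and both of these are equality.
      have h4 := (hp.inf_setoid hp').inf_sup_le hq hq' ⟨⟨h1, h2⟩, (quotMk_eq hT).mp h3⟩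
      refine setoid_sup_le (r := (Setoid.ker p.toFun ⊓ Setoid.ker p'.toFun) ⊓ Setoid.ker q.toFun)
        (s := (Setoid.ker p.toFun ⊓ Setoid.ker p'.toFun) ⊓ Setoid.ker q'.toFun)
        (p := fun x y : A => x = y) (fun _ => rfl) (fun _ _ => Eq.symm)
        (fun _ _ _ => Eq.trans) (fun x y ⟨⟨h, _⟩, k⟩ => hf (Prod.ext h k))
        (fun x y ⟨⟨_, h⟩, k⟩ => hf' (Prod.ext h k)) h4
    · exact ⟨X', Or.inl hX', p', h2⟩
  · exact ⟨X, Or.inl hX, p, h1⟩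

/-! ### Identities -/

/-- Terms in the language of Brouwer-Zadeh lattices. -/
inductive Term (X : Type)
  | var (x : X)
  | bot
  | top
  | inf (s t : Term X)
  | sup (s t : Term X)
  | kl (t : Term X)
  | br (t : Term X)

/-- The value of a term under an assignment. -/
def Term.eval {X : Type} {A : Type*} [BZLattice A] (v : X → A) : Term X → A
  | .var x => v x
  | .bot => ⊥
  | .top => ⊤
  | .inf s t => s.eval v ⊓ t.eval v
  | .sup s t => s.eval v ⊔ t.eval v
  | .kl t => BZLattice.kl (t.eval v)
  | .br t => BZLattice.br (t.eval v)

theorem Term.map_eval {X : Type} {A B : Type*} [BZLattice A] [BZLattice B] (f : BZHom A B)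
    (v : X → A) (t : Term X) : f (t.eval v) = t.eval fun x => f (v x) := by
  induction t with
  | var x => rfl
  | bot => exact f.map_bot
  | top => exact f.map_top
  | inf s t hs ht => rw [eval, f.map_inf, hs, ht, eval]
  | sup s t hs ht => rw [eval, f.map_sup, hs, ht, eval]
  | kl t ht => rw [eval, f.map_kl, ht, eval]
  | br t ht => rw [eval, f.map_br, ht, eval]

/-- The algebras satisfying the identity `s ≈ t`. -/
def Mod {X : Type} (s t : Term X) : Set BZLat.{u} := {A | ∀ v : X → A, s.eval v = t.eval v}

theorem isVariety_Mod {X : Type} (s t : Term X) : IsVariety (Mod.{u} s t) := by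
  intro A hA v
  obtain ⟨I, B, D, g, f, hB, hg, hf⟩ := mem_V_iff.mp hA
  choose w hw using fun x => hf (v x)
  obtain rfl : (fun x => f (w x)) = v := funext hw
  rw [← Term.map_eval, ← Term.map_eval]
  congr 1
  refine hg (funext fun i => ?_)
  have := hB i fun x => g (w x) i
  have h := Term.map_eval ((BZHom.proj (fun i => B i) i).comp g) w
  simp only [BZHom.comp_apply, BZHom.proj_apply] at h
  rwa [h, h]

end BZLat

/-! ### Distributive algebras: complemented elements, localization, prime filters. -/

namespace BZLattice

variable {L : Type*} [BZLattice L]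

theorem inf_sup_distrib_right (hd : ∀ a b c : L, a ⊓ (b ⊔ c) = (a ⊓ b) ⊔ (a ⊓ c)) (a b c : L) :
    (a ⊔ b) ⊓ c = (a ⊓ c) ⊔ (b ⊓ c) := by
  rw [inf_comm, hd, inf_comm c, inf_comm c]

/-- In the distributive case, paraorthomodularity is automatic. -/
theorem paraorthomodular_of_distrib (hd : ∀ a b c : L, a ⊓ (b ⊔ c) = (a ⊓ b) ⊔ (a ⊓ c)) (a b : L)
    (hab : a ≤ b) (h : kl a ⊓ b = ⊥) : a = b := by
  refine le_antisymm hab ?_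
  have h1 : a ⊔ kl b = ⊤ := by rw [← kl_kl (a ⊔ kl b), kl_sup, kl_kl, h, kl_bot]
  have h2 : b ⊓ kl b ≤ ⊥ := by
    rw [← h, inf_comm]
    exact inf_le_inf_right _ (kl_anti _ _ hab)
  calc b = b ⊓ (a ⊔ kl b) := by rw [h1, inf_top_eq]
    _ = (b ⊓ a) ⊔ (b ⊓ kl b) := hd _ _ _
    _ ≤ a := sup_le inf_le_right (h2.trans bot_le)

/-- The complemented elements are those fixed by the double Brouwer complement. -/
theorem br_eq_kl_of_inf_kl (hd : ∀ a b c : L, a ⊓ (b ⊔ c) = (a ⊓ b) ⊔ (a ⊓ c))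
    (hst : ∀ a : L, br (a ⊓ kl a) = br a ⊔ br (kl a)) {s : L} (hs : s ⊓ kl s = ⊥) :
    br s = kl s := by
  refine le_antisymm (br_le_kl s) ?_
  have h : br s ⊔ br (kl s) = ⊤ := by rw [← hst, hs, br_bot]
  calc kl s = kl s ⊓ (br s ⊔ br (kl s)) := by rw [h, inf_top_eq]
    _ = (kl s ⊓ br s) ⊔ (kl s ⊓ br (kl s)) := hd _ _ _
    _ ≤ br s := by rw [inf_br, sup_bot_eq]; exact inf_le_right

theorem br_inf_kl_br (a : L) : br a ⊓ kl (br a) = ⊥ := by rw [← br_br, inf_br]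

theorem inf_kl_inf (hd : ∀ a b c : L, a ⊓ (b ⊔ c) = (a ⊓ b) ⊔ (a ⊓ c)) {s t : L}
    (hs : s ⊓ kl s = ⊥) (ht : t ⊓ kl t = ⊥) : (s ⊓ t) ⊓ kl (s ⊓ t) = ⊥ := by
  rw [kl_inf, hd, eq_bot_iff]
  refine sup_le ?_ ?_
  · rw [← hs]; exact inf_le_inf_right _ inf_le_left
  · rw [← ht]; exact inf_le_inf_right _ inf_le_right

theorem sup_inf_kl_sup (hd : ∀ a b c : L, a ⊓ (b ⊔ c) = (a ⊓ b) ⊔ (a ⊓ c)) {s t : L}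
    (hs : s ⊓ kl s = ⊥) (ht : t ⊓ kl t = ⊥) : (s ⊔ t) ⊓ kl (s ⊔ t) = ⊥ := by
  rw [kl_sup, inf_sup_distrib_right hd, eq_bot_iff]
  refine sup_le ?_ ?_
  · rw [← hs]; exact inf_le_inf_left _ inf_le_left
  · rw [← ht]; exact inf_le_inf_left _ inf_le_right

/-- The element `t = (a ∧ s)~ ∧ s` is complemented and disjoint from `a`, so `a ≤ t'` and `t = t'~ ≤
a~`. This makes the localization compatible with `br`. -/
theorem br_inf_inf (hd : ∀ a b c : L, a ⊓ (b ⊔ c) = (a ⊓ b) ⊔ (a ⊓ c))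
    (hst : ∀ a : L, br (a ⊓ kl a) = br a ⊔ br (kl a)) {s : L} (hs : s ⊓ kl s = ⊥) (a : L) :
    br (a ⊓ s) ⊓ s = br a ⊓ s := by
  refine le_antisymm (le_inf ?_ inf_le_right)
    (inf_le_inf_right _ (br_anti _ _ inf_le_left))
  set t := br (a ⊓ s) ⊓ s with ht
  have htt : t ⊓ kl t = ⊥ := inf_kl_inf hd (br_inf_kl_br _) hs
  have hat : a ⊓ t = ⊥ := by
    rw [ht, inf_comm (br _), ← inf_assoc, inf_br]
  have htop : t ⊔ kl t = ⊤ := by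
    rw [← kl_kl (t ⊔ kl t), kl_sup, kl_kl, inf_comm, htt, kl_bot]
  have h1 : a ≤ kl t := by
    calc a = a ⊓ (t ⊔ kl t) := by rw [htop, inf_top_eq]
      _ = (a ⊓ t) ⊔ (a ⊓ kl t) := hd _ _ _
      _ ≤ kl t := by rw [hat, bot_sup_eq]; exact inf_le_right
  have h2 : br (kl t) = t := by
    rw [br_eq_kl_of_inf_kl hd hst (by rw [kl_kl, inf_comm, htt]), kl_kl]
  rw [← h2]
  exact br_anti _ _ h1

/-- The kernel of the localization at a prime filter, with respect to complemented elements. -/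
def localSetoid (hd : ∀ a b c : L, a ⊓ (b ⊔ c) = (a ⊓ b) ⊔ (a ⊓ c)) (P : L → Prop) (htop : P ⊤)
    (hinf : ∀ a b, P a → P b → P (a ⊓ b)) : Setoid L where
  r a b := ∃ s, P s ∧ s ⊓ kl s = ⊥ ∧ a ⊓ s = b ⊓ s
  iseqv :=
    { refl := fun _ => ⟨⊤, htop, by rw [kl_top, inf_bot_eq], rfl⟩
      symm := fun ⟨s, h1, h2, h3⟩ => ⟨s, h1, h2, h3.symm⟩
      trans := fun ⟨s, h1, h2, h3⟩ ⟨t, k1, k2, k3⟩ => ⟨s ⊓ t, hinf _ _ h1 k1, inf_kl_inf hd h2 k2, by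
        rw [← inf_assoc, h3, inf_right_comm, k3, inf_right_comm, inf_assoc]⟩ }

theorem isCong_localSetoid (hd : ∀ a b c : L, a ⊓ (b ⊔ c) = (a ⊓ b) ⊔ (a ⊓ c))
    (hst : ∀ a : L, br (a ⊓ kl a) = br a ⊔ br (kl a)) (P : L → Prop) (htop : P ⊤)
    (hinf : ∀ a b, P a → P b → P (a ⊓ b)) : IsCong (localSetoid hd P htop hinf) where
  inf {a b c d} := fun ⟨s, h1, h2, h3⟩ ⟨t, k1, k2, k3⟩ =>
    ⟨s ⊓ t, hinf _ _ h1 k1, inf_kl_inf hd h2 k2, by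
      rw [inf_inf_inf_comm, h3, k3, inf_inf_inf_comm]⟩
  sup {a b c d} := fun ⟨s, h1, h2, h3⟩ ⟨t, k1, k2, k3⟩ =>
    ⟨s ⊓ t, hinf _ _ h1 k1, inf_kl_inf hd h2 k2, by
      rw [inf_sup_distrib_right hd, inf_sup_distrib_right hd, ← inf_assoc, h3, inf_assoc,
        inf_left_comm c, k3, inf_left_comm s]⟩
  kl {a b} := fun ⟨s, h1, h2, h3⟩ => ⟨s, h1, h2, by
    have key : ∀ x, kl x ⊓ s = kl (x ⊓ s) ⊓ s := fun x => by
      rw [kl_inf, inf_sup_distrib_right hd, inf_comm (kl s), h2, sup_bot_eq]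
    rw [key a, key b, h3]⟩
  br {a b} := fun ⟨s, h1, h2, h3⟩ => ⟨s, h1, h2, by
    rw [← br_inf_inf hd hst h2 a, ← br_inf_inf hd hst h2 b, h3]⟩

/-- Prime filters, as characteristic functions preserving the lattice operations and bounds. -/
structure IsPrimeFilter (P : L → Prop) : Prop where
  top : P ⊤
  bot : ¬ P ⊥
  inf : ∀ a b, P (a ⊓ b) ↔ P a ∧ P b
  sup : ∀ a b, P (a ⊔ b) ↔ P a ∨ P b

theorem IsPrimeFilter.mono {P : L → Prop} (hP : IsPrimeFilter P) {a b : L} (h : a ≤ b) (ha : P a) :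
    P b := by
  rw [← sup_eq_right.mpr h, hP.sup]
  exact Or.inl ha

theorem IsPrimeFilter.dual {P : L → Prop} (hP : IsPrimeFilter P) :
    IsPrimeFilter fun a => ¬ P (kl a) where
  top := by rw [kl_top]; exact hP.bot
  bot := by rw [kl_bot]; exact not_not_intro hP.top
  inf a b := by rw [kl_inf, hP.sup, not_or]
  sup a b := by rw [kl_sup, hP.inf, not_and_or]

/-- Strong De Morgan enters precisely in the `inf` clause. -/
theorem IsPrimeFilter.not_br {P : L → Prop} (hP : IsPrimeFilter P)
    (hsdm : ∀ a b : L, br (a ⊓ b) = br a ⊔ br b) : IsPrimeFilter fun a => ¬ P (br a) where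
  top := by rw [br_top]; exact hP.bot
  bot := by rw [br_bot]; exact not_not_intro hP.top
  inf a b := by rw [hsdm, hP.sup, not_or]
  sup a b := by rw [br_sup, hP.inf, not_and_or]

/-- The prime filter theorem. -/
theorem exists_isPrimeFilter (hd : ∀ a b c : L, a ⊓ (b ⊔ c) = (a ⊓ b) ⊔ (a ⊓ c)) (I : Order.Ideal L)
    {c : L} (hc : c ∉ I) : ∃ P : L → Prop, IsPrimeFilter P ∧ P c ∧ ∀ a ∈ I, ¬ P a := by
  let _ : DistribLattice L := DistribLattice.ofInfSupLe fun a b c => (hd a b c).le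
  obtain ⟨J, hJ, hIJ, hFJ⟩ := DistribLattice.prime_ideal_of_disjoint_filter_ideal
    (F := Order.PFilter.principal c) (I := I) (Set.disjoint_left.mpr fun x hx hxI =>
      hc (I.lower (Order.PFilter.mem_principal.mp hx) hxI))
  refine ⟨fun a => a ∉ J, ⟨?_, ?_, fun a b => ?_, fun a b => ?_⟩, ?_, fun a ha => ?_⟩
  · exact fun h => hJ.toIsProper.ne_univ (Set.eq_univ_of_forall fun x => J.lower le_top h)
  · exact not_not_intro J.bot_mem
  · rw [← not_or, not_iff_not]
    exact ⟨hJ.mem_or_mem, fun h => h.elim (J.lower inf_le_left) (J.lower inf_le_right)⟩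
  · rw [← not_and_or, not_iff_not]
    exact Order.Ideal.sup_mem_iff
  · exact fun h => Set.disjoint_left.mp hFJ (Order.PFilter.mem_principal.mpr le_rfl) h
  · exact not_not_intro (hIJ ha)

/-! ### Coordinates in the five-element chain. -/

open Classical in
/-- The position in a five-element chain determined by four nested propositions. -/
noncomputable def level (p q r s : Prop) : ULift.{u} (Fin 5) :=
  ⟨if p then 4 else if q then 3 else if r then 2 else if s then 1 else 0⟩

theorem level_inf {p q r s p' q' r' s' : Prop} (h1 : p → q) (h2 : q → r) (h3 : r → s)
    (k1 : p' → q') (k2 : q' → r') (k3 : r' → s') :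
    level.{u} (p ∧ p') (q ∧ q') (r ∧ r') (s ∧ s') = level p q r s ⊓ level p' q' r' s' := by
  apply ULift.ext
  change _ = min (level.{u} p q r s).down (level.{u} p' q' r' s').down
  unfold level
  grind

/-- No nesting is needed: the first true disjunction gives the maximum. Meets do need it. -/
theorem level_sup (p q r s p' q' r' s' : Prop) :
    level.{u} (p ∨ p') (q ∨ q') (r ∨ r') (s ∨ s') = level p q r s ⊔ level p' q' r' s' := by
  apply ULift.ext
  change _ = max (level.{u} p q r s).down (level.{u} p' q' r' s').down
  unfold level
  grind

theorem level_kl {p q r s : Prop} (h1 : p → q) (h2 : q → r) (h3 : r → s) :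
    level.{u} (¬ s) (¬ r) (¬ q) (¬ p) = kl (level p q r s) := by
  apply ULift.ext
  change _ = (level.{u} p q r s).down.rev
  unfold level
  split_ifs <;> first | rfl | tauto

theorem level_br {p q r s : Prop} (h1 : p → q) (h2 : q → r) (h3 : r → s) :
    level.{u} (¬ s) (¬ s) (¬ s) (¬ s) = br (level p q r s) := by
  by_cases h : s
  · have h0 : (level.{u} p q r s).down ≠ 0 := by
      unfold level
      split_ifs <;> decide
    change _ = if (level.{u} p q r s).down = 0 then _ else _
    rw [if_neg h0]
    simp [level, h]
  · have h0 : (level.{u} p q r s).down = 0 := by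
      unfold level
      split_ifs <;> tauto
    change _ = if (level.{u} p q r s).down = 0 then _ else _
    rw [if_pos h0]
    simp [level, h]

theorem iff_of_level_eq {p q r s p' q' r' s' : Prop} (h1 : p → q) (h2 : q → r) (k1 : p' → q')
    (k2 : q' → r') (h : level.{u} p q r s = level p' q' r' s') : (q ↔ q') ∧ (r ↔ r') := by
  have h := congrArg ULift.down h
  unfold level at h
  grind

end BZLattice

/-! ### Subdirect representations of distributive PBZ*-lattices. -/

namespace BZLat

open BZLattice

/-- Four nested prime filters, interchanged by the complements, define a homomorphism onto a
subalgebra of the five-element chain. -/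
theorem exists_hom_chain_five {A : BZLat.{u}} {F₁ F₂ F₃ F₄ : A → Prop} (h₁ : IsPrimeFilter F₁)
    (h₂ : IsPrimeFilter F₂) (h₃ : IsPrimeFilter F₃) (h₄ : IsPrimeFilter F₄)
    (h₁₂ : ∀ a, F₁ a → F₂ a) (h₂₃ : ∀ a, F₂ a → F₃ a) (h₃₄ : ∀ a, F₃ a → F₄ a)
    (hkl : ∀ a, F₁ (kl a) ↔ ¬ F₄ a) (hkl' : ∀ a, F₂ (kl a) ↔ ¬ F₃ a)
    (hbr : ∀ a, F₁ (br a) ↔ ¬ F₄ a) (hbr' : ∀ a, F₄ (br a) ↔ ¬ F₄ a) :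
    ∃ f : BZHom A (chain.{u} 5), ∀ a b, f a = f b → (F₂ a ↔ F₂ b) ∧ (F₃ a ↔ F₃ b) := by
  refine ⟨BZHom.ofFun (fun a => level (F₁ a) (F₂ a) (F₃ a) (F₄ a)) (fun a b => ?_) (fun a b => ?_)
    ?_ ?_ (fun a => ?_) (fun a => ?_),
    fun a b h => iff_of_level_eq (h₁₂ a) (h₂₃ a) (h₁₂ b) (h₂₃ b) h⟩
  · rw [← level_inf (h₁₂ a) (h₂₃ a) (h₃₄ a) (h₁₂ b) (h₂₃ b) (h₃₄ b), h₁.inf, h₂.inf, h₃.inf, h₄.inf]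
  · rw [← level_sup, h₁.sup, h₂.sup, h₃.sup, h₄.sup]
  · simp only [level, h₁.bot, h₂.bot, h₃.bot, h₄.bot, if_false]
    rfl
  · simp only [level, h₁.top, if_true]
    rfl
  · have h3 : F₃ (kl a) ↔ ¬ F₂ a := by rw [iff_not_comm, ← hkl', kl_kl]
    have h4 : F₄ (kl a) ↔ ¬ F₁ a := by rw [iff_not_comm, ← hkl, kl_kl]
    rw [← level_kl (h₁₂ a) (h₂₃ a) (h₃₄ a), hkl, hkl', h3, h4]
  · have h2 : F₂ (br a) ↔ ¬ F₄ a :=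
      ⟨fun h => (hbr' a).mp (h₃₄ _ (h₂₃ _ h)), fun h => h₁₂ _ ((hbr a).mpr h)⟩
    have h3 : F₃ (br a) ↔ ¬ F₄ a :=
      ⟨fun h => (hbr' a).mp (h₃₄ _ h), fun h => h₂₃ _ (h₁₂ _ ((hbr a).mpr h))⟩
    rw [← level_br (h₁₂ a) (h₂₃ a) (h₃₄ a), hbr, h2, h3, hbr']

/-- The identity `(x ∧ y)~ ≈ x~ ∨ y~`. -/
def sdmMod : Set BZLat.{u} :=
  Mod (X := Fin 2) (.br (.inf (.var 0) (.var 1))) (.sup (.br (.var 0)) (.br (.var 1)))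

theorem mem_sdmMod {A : BZLat.{u}} : A ∈ sdmMod ↔ ∀ a b : A, br (a ⊓ b) = br a ⊔ br b :=
  ⟨fun h a b => h ![a, b], fun h v => h (v 0) (v 1)⟩

theorem isVariety_sdmMod : IsVariety sdmMod.{u} := isVariety_Mod _ _

theorem mem_DIST_iff {A : BZLat.{u}} : A ∈ DIST ↔
    (∀ a b c : A, a ⊓ (b ⊔ c) = (a ⊓ b) ⊔ (a ⊓ c)) ∧
      ∀ a : A, br (a ⊓ kl a) = br a ⊔ br (kl a) :=
  ⟨fun h => ⟨h.2, h.1.2⟩, fun h => ⟨⟨paraorthomodular_of_distrib h.1, h.2⟩, h.1⟩⟩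

/-- Paraorthomodularity is a quasi-identity, but distributivity implies it, so identities suffice.
-/
theorem isVariety_DIST : IsVariety DIST.{u} := by
  have : DIST.{u} = Mod (X := Fin 3) (.inf (.var 0) (.sup (.var 1) (.var 2)))
        (.sup (.inf (.var 0) (.var 1)) (.inf (.var 0) (.var 2))) ∩
      Mod (X := Unit) (.br (.inf (.var ()) (.kl (.var ()))))
        (.sup (.br (.var ())) (.br (.kl (.var ())))) := by
    ext A
    rw [mem_DIST_iff]
    exact ⟨fun h => ⟨fun v => h.1 (v 0) (v 1) (v 2), fun v => h.2 (v ())⟩,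
      fun h => ⟨fun a b c => h.1 ![a, b, c], fun a => h.2 fun _ => a⟩⟩
  rw [this]
  exact (isVariety_Mod _ _).inter (isVariety_Mod _ _)

theorem isVariety_OML : IsVariety OML.{u} := by
  -- Writing `a ∨ b` for `b` turns the condition `a ≤ b` into an identity.
  have : OML.{u} = Mod (X := Fin 2) (.sup (.var 0) (.var 1))
        (.sup (.inf (.sup (.var 0) (.var 1)) (.kl (.var 0))) (.var 0)) ∩
      Mod (X := Unit) (.br (.var ())) (.kl (.var ())) := by
    ext A
    refine ⟨fun h => ⟨fun v => h.1 _ _ le_sup_left, fun v => h.2 (v ())⟩,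
      fun h => ⟨fun a b hab => ?_, fun a => h.2 fun _ => a⟩⟩
    have := h.1 ![a, b]
    change a ⊔ b = ((a ⊔ b) ⊓ kl a) ⊔ a at this
    rwa [sup_eq_right.mpr hab] at this
  rw [this]
  exact (isVariety_Mod _ _).inter (isVariety_Mod _ _)

/-- A prime filter `P` containing `x` but not `y` lies, with its dual `{a | a' ∉ P}`, between `{a |
a'~ ∈ P}` and `{a | a~ ∉ P}`. These four form a chain and give a map to `D₅` separating `x` from
`y`. -/
theorem DIST_inter_sdmMod_subset : DIST ∩ sdmMod ⊆ V {chain.{u} 5} := by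
  rintro A ⟨hA, hA'⟩
  rw [mem_sdmMod] at hA'
  refine mem_V_of_separating fun a b hab => ⟨_, rfl, ?_⟩
  have key : ∀ x y : A, ¬ x ≤ y → ∃ f : BZHom A (chain.{u} 5), f x ≠ f y := by
    intro x y hxy
    obtain ⟨P, hP, hx, hy⟩ := exists_isPrimeFilter hA.2 (Order.Ideal.principal y) (c := x)
      (by rwa [Order.Ideal.mem_principal])
    replace hy : ¬ P y := hy y (Order.Ideal.mem_principal.mpr le_rfl)
    have h₄ := hP.not_br hA'
    have h₁ := h₄.dual
    have hD := hP.dual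
    simp only [not_not] at h₁
    have hP₄ : ∀ a, P a → ¬ P (br a) := fun a h k =>
      hP.bot (by rw [← inf_br a]; exact (hP.inf _ _).mpr ⟨h, k⟩)
    have hnot : ∀ s : A, s ⊓ kl s = ⊥ → (P (kl s) ↔ ¬ P s) := fun s hs =>
      ⟨fun h k => hP.bot (by rw [← hs]; exact (hP.inf _ _).mpr ⟨k, h⟩), fun h => by
        have : P (s ⊔ kl s) := by
          rw [← kl_kl (s ⊔ kl s), kl_sup, kl_kl, inf_comm, hs, kl_bot]; exact hP.top
        exact ((hP.sup _ _).mp this).resolve_left h⟩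
    have hbr : ∀ a, P (br (br a)) ↔ ¬ P (br a) := fun a => by
      rw [br_br, hnot _ (br_inf_kl_br a)]
    have h1P : ∀ a, P (br (kl a)) → P a := fun a => hP.mono (by
      conv_rhs => rw [← kl_kl a]
      exact br_le_kl _)
    have h1D : ∀ a, P (br (kl a)) → ¬ P (kl a) := fun a h k => hP₄ _ k h
    have hD4 : ∀ a, ¬ P (kl a) → ¬ P (br a) := fun a => mt (hP.mono (br_le_kl a))
    have hkl : ∀ a, P (br (kl (kl a))) ↔ ¬ ¬ P (br a) := fun a => by rw [kl_kl, not_not]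
    have hbr1 : ∀ a, P (br (kl (br a))) ↔ ¬ ¬ P (br a) := fun a => by
      rw [← br_br, br_br_br, not_not]
    have hbr4 : ∀ a, ¬ P (br (br a)) ↔ ¬ ¬ P (br a) := fun a => by rw [hbr]
    -- Either `P` is inside its dual, or some `c ∧ c'` is in `P`; then the Kleene law puts every `a
    -- ∨ a'` in `P` and the dual is inside `P`. The middle filters are ordered accordingly.
    by_cases hK : ∀ a, P a → ¬ P (kl a)
    · obtain ⟨f, hf⟩ := exists_hom_chain_five h₁ hP hD h₄ h1P hK hD4 hkl
        (fun a => by rw [not_not]) hbr1 hbr4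
      exact ⟨f, fun h => hy ((hf x y h).1.mp hx)⟩
    · push Not at hK
      obtain ⟨c, hc, hc'⟩ := hK
      have hK' : ∀ a, ¬ P (kl a) → P a := fun a h => by
        have := hP.mono (inf_kl_le_sup_kl c a) ((hP.inf _ _).mpr ⟨hc, hc'⟩)
        exact ((hP.sup _ _).mp this).resolve_right h
      obtain ⟨f, hf⟩ := exists_hom_chain_five h₁ hD hP h₄ h1D hK' hP₄ hkl
        (fun a => by rw [kl_kl]) hbr1 hbr4
      exact ⟨f, fun h => hy ((hf x y h).2.mp hx)⟩
  by_cases h : a ≤ b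
  · obtain ⟨f, hf⟩ := key b a fun h' => hab (le_antisymm h h')
    exact ⟨f, hf.symm⟩
  · exact key a b h

/-- Distinct elements stay distinct in a localization at a suitable prime filter, and every such
localization is an antiortholattice because a prime filter contains each complemented element or its
complement. -/
theorem DIST_subset_V_AOL : DIST.{u} ⊆ V AOL := by
  intro A hA
  have hd := hA.2
  have hst := hA.1.2
  refine mem_V_of_separating fun a b hab => ?_
  -- The ideal generated by the complemented elements below which `a` and `b` agree; it is proper as
  -- `a ≠ b`.
  let I : Order.Ideal A := Order.IsIdeal.toIdeal (I := {z | ∃ s, z ≤ s ∧ s ⊓ kl s = ⊥ ∧ a ⊓ s = b ⊓ s})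
    { IsLowerSet := fun x y hyx ⟨s, h1, h2⟩ => ⟨s, hyx.trans h1, h2⟩
      Nonempty := ⟨⊥, ⊥, le_rfl, bot_inf_eq _, by rw [inf_bot_eq, inf_bot_eq]⟩
      Directed := fun x ⟨s, h1, h2, h3⟩ y ⟨t, k1, k2, k3⟩ => ⟨s ⊔ t, ⟨s ⊔ t, le_rfl,
        sup_inf_kl_sup hd h2 k2, by rw [hd, hd, h3, k3]⟩, h1.trans le_sup_left,
        k1.trans le_sup_right⟩ }
  obtain ⟨P, hP, -, hPI⟩ := exists_isPrimeFilter hd I (c := ⊤) fun ⟨s, h1, h2, h3⟩ => hab (by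
    rwa [top_le_iff.mp h1, inf_top_eq, inf_top_eq] at h3)
  have hr := isCong_localSetoid hd hst P hP.top fun a b h k => (hP.inf a b).mpr ⟨h, k⟩
  refine ⟨quot hr, ⟨(isVariety_DIST.surjective hA (quotMk hr) (quotMk_surjective hr)).1, ?_⟩,
    quotMk hr, fun h => ?_⟩
  · intro y hy
    obtain ⟨c, rfl⟩ := quotMk_surjective hr y
    have hy' : quotMk hr (c ⊔ kl c) = quotMk hr ⊤ := by
      rw [BZHom.map_sup, BZHom.map_kl, BZHom.map_top]; exact hy
    obtain ⟨s, h1, h2, h3⟩ := (quotMk_eq hr).mp hy'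
    have hs : s ≤ c ⊔ kl c := by
      rw [top_inf_eq, inf_eq_right] at h3; exact h3
    have hs' : c ⊓ kl c ≤ kl s := by
      have := kl_anti _ _ hs
      rwa [kl_sup, kl_kl, inf_comm] at this
    -- A sharp class is represented by some `c` with `s ≤ c ∨ c'`; hence `c ∧ s` is complemented in
    -- `A`, and primality decides whether the class is `1` or `0`.
    have ht : (c ⊓ s) ⊓ kl (c ⊓ s) = ⊥ := by
      rw [kl_inf, hd, eq_bot_iff]
      refine sup_le ?_ ?_
      · rw [← h2]
        exact le_inf (inf_le_left.trans inf_le_right)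
          ((inf_le_inf_right _ inf_le_left).trans hs')
      · rw [← h2]
        exact inf_le_inf_right _ inf_le_right
    have htop : (c ⊓ s) ⊔ kl (c ⊓ s) = ⊤ := by
      rw [← kl_kl (c ⊓ s ⊔ kl (c ⊓ s)), kl_sup, kl_kl, inf_comm, ht, kl_bot]
    have : P ((c ⊓ s) ⊔ kl (c ⊓ s)) := by rw [htop]; exact hP.top
    rcases (hP.sup _ _).mp this with h | h
    · right
      rw [← BZHom.map_top (quotMk hr), quotMk_eq]
      exact ⟨c ⊓ s, h, ht, by rw [← inf_assoc, inf_idem, top_inf_eq]⟩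
    · left
      rw [← BZHom.map_bot (quotMk hr), quotMk_eq]
      refine ⟨kl (c ⊓ s) ⊓ s, (hP.inf _ _).mpr ⟨h, h1⟩,
        inf_kl_inf hd (by rw [kl_kl, inf_comm, ht]) h2, ?_⟩
      rw [bot_inf_eq, ← ht, inf_comm (kl _) s, inf_assoc]
  · obtain ⟨s, h1, h2, h3⟩ := (quotMk_eq hr).mp h
    exact hPI s ⟨s, le_rfl, h2, h3⟩ h1

end BZLat

/-! ### Antiortholattices from ordinal sums. -/

/-- The ordinal sum of a bounded lattice and its dual; `hi a` is the dual copy of `lo a`. -/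
inductive Stack (M : Type u)
  | lo (a : M)
  | hi (a : M)

namespace Stack

open BZLattice

variable {M : Type u} [Lattice M] [BoundedOrder M]

/-- The order of the ordinal sum. -/
def le : Stack M → Stack M → Prop
  | lo a, lo b => a ≤ b
  | lo _, hi _ => True
  | hi _, lo _ => False
  | hi a, hi b => b ≤ a

/-- Joins in the ordinal sum. -/
def sup : Stack M → Stack M → Stack M
  | lo a, lo b => lo (a ⊔ b)
  | lo _, hi b => hi b
  | hi a, lo _ => hi a
  | hi a, hi b => hi (a ⊓ b)

/-- Meets in the ordinal sum. -/
def inf : Stack M → Stack M → Stack M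
  | lo a, lo b => lo (a ⊓ b)
  | lo a, hi _ => lo a
  | hi _, lo b => lo b
  | hi a, hi b => hi (a ⊔ b)

/-- The involution of the ordinal sum. -/
def swap : Stack M → Stack M
  | lo a => hi a
  | hi a => lo a

open Classical in
/-- The ordinal sum of a nontrivial bounded lattice and its dual, with the trivial Brouwer
complement. -/
noncomputable instance [Nontrivial M] : BZLattice (Stack M) where
  le := le
  le_refl a := by cases a <;> simp [le]
  le_trans a b c h k := by
    cases a <;> cases b <;> cases c <;> simp only [le] at h k ⊢
    · exact h.trans k
    · exact k.trans h
  le_antisymm a b h k := by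
    cases a <;> cases b <;> simp only [le] at h k
    · rw [le_antisymm h k]
    · rw [le_antisymm h k]
  sup := sup
  inf := inf
  le_sup_left a b := by cases a <;> cases b <;> simp [le, sup]
  le_sup_right a b := by cases a <;> cases b <;> simp [le, sup]
  sup_le a b c h k := by
    cases a <;> cases b <;> cases c <;> simp_all [le, sup]
  inf_le_left a b := by cases a <;> cases b <;> simp [le, inf]
  inf_le_right a b := by cases a <;> cases b <;> simp [le, inf]
  le_inf a b c h k := by
    cases a <;> cases b <;> cases c <;> simp_all [le, inf]
  top := hi ⊥
  bot := lo ⊥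
  le_top a := by cases a <;> simp [le]
  bot_le a := by cases a <;> simp [le]
  kl := swap
  br a := if a = lo ⊥ then hi ⊥ else lo ⊥
  kl_anti a b h := by cases a <;> cases b <;> simp_all [le, swap]
  kl_kl a := by cases a <;> rfl
  inf_kl_le_sup_kl a b := by
    change le (inf a (swap a)) (sup b (swap b))
    cases a <;> cases b <;> trivial
  br_anti a b h := by
    split_ifs with hb ha ha
    · cases a <;> simp_all [le]
    · cases a <;> simp_all [le]
    · simp [le]
    · simp [le]
  inf_br a := by
    split_ifs with h
    · rw [h]; rfl
    · change inf a (lo ⊥) = lo ⊥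
      cases a <;> simp [inf]
  le_br_br a := by
    by_cases h : a = lo ⊥
    · simp [h, le]
    · cases a <;> simp [h, le]
  br_br a := by
    by_cases h : a = lo ⊥ <;> simp [h, swap]

variable [Nontrivial M]

theorem lo_inf_lo (a b : M) : lo a ⊓ lo b = lo (a ⊓ b) := rfl

theorem lo_sup_lo (a b : M) : lo a ⊔ lo b = lo (a ⊔ b) := rfl

/-- Identities in the terms `x ∧ x'` thereby become statements about `M`. -/
theorem lo_inf_kl (a : M) : lo a ⊓ kl (lo a) = lo a := rfl

theorem bot_def : (⊥ : Stack M) = lo ⊥ := rfl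

theorem top_def : (⊤ : Stack M) = hi ⊥ := rfl

theorem br_of_ne_bot {a : Stack M} (h : a ≠ ⊥) : br a = ⊥ := if_neg h

theorem br_hi (a : M) : br (hi a) = ⊥ := br_of_ne_bot (by rw [bot_def]; simp)

/-- The join of an element with its complement is whichever of the two lies in the upper half, so it
is `1` only at the bounds. -/
theorem mem_AOL : (⟨Stack M⟩ : BZLat.{u}) ∈ BZLat.AOL := by
  refine ⟨⟨fun a b hab h => ?_, fun a => ?_⟩, fun a h => ?_⟩
  · change le a b at hab
    change inf (swap a) b = lo ⊥ at h
    cases a <;> cases b <;> simp_all [le, inf, swap]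
  · cases a with
    | lo a =>
      change br (lo a) = br (lo a) ⊔ br (hi a)
      rw [br_hi, sup_bot_eq]
    | hi a =>
      change br (lo a) = br (hi a) ⊔ br (lo a)
      rw [br_hi, bot_sup_eq]
  · change sup a (swap a) = hi ⊥ at h
    change a = lo ⊥ ∨ a = hi ⊥
    cases a with
    | lo a => exact Or.inl (congrArg lo (hi.inj h))
    | hi a => exact Or.inr h

theorem inf_sup_distrib (hd : ∀ a b c : M, a ⊓ (b ⊔ c) = (a ⊓ b) ⊔ (a ⊓ c)) (a b c : Stack M) :
    a ⊓ (b ⊔ c) = (a ⊓ b) ⊔ (a ⊓ c) := by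
  have hd' : ∀ a b c : M, a ⊔ (b ⊓ c) = (a ⊔ b) ⊓ (a ⊔ c) := by
    let _ : DistribLattice M := DistribLattice.ofInfSupLe fun a b c => (hd a b c).le
    exact sup_inf_left
  change inf a (sup b c) = sup (inf a b) (inf a c)
  cases a <;> cases b <;> cases c <;> simp only [inf, sup]
  · rw [hd]
  · rw [sup_eq_right.mpr inf_le_left]
  · rw [sup_eq_left.mpr inf_le_left]
  · rw [sup_idem]
  · rw [hd']

theorem mem_DIST (hd : ∀ a b c : M, a ⊓ (b ⊔ c) = (a ⊓ b) ⊔ (a ⊓ c)) :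
    (⟨Stack M⟩ : BZLat.{u}) ∈ BZLat.DIST :=
  ⟨mem_AOL.1, inf_sup_distrib hd⟩

/-- For the trivial Brouwer complement, strong De Morgan says that nonzero elements have nonzero
meet. -/
theorem mem_SAOL (hM : ∀ a b : M, a ⊓ b = ⊥ → a = ⊥ ∨ b = ⊥) :
    (⟨Stack M⟩ : BZLat.{u}) ∈ BZLat.SAOL := by
  refine ⟨⟨mem_AOL.1, fun a b => ?_⟩, BZLat.subset_V _ mem_AOL⟩
  by_cases ha : a = ⊥
  · rw [ha, bot_inf_eq, br_bot, top_sup_eq]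
  by_cases hb : b = ⊥
  · rw [hb, inf_bot_eq, br_bot, sup_top_eq]
  have hab : a ⊓ b ≠ ⊥ := by
    change inf a b ≠ lo ⊥
    change a ≠ lo ⊥ at ha
    change b ≠ lo ⊥ at hb
    cases a <;> cases b <;> simp_all [inf]
    rename_i a b
    exact fun h => (hM a b h).elim ha hb
  rw [br_of_ne_bot ha, br_of_ne_bot hb, br_of_ne_bot hab, sup_bot_eq]

end Stack

/-! ### The diamond, a non-distributive building block. -/

/-- The diamond: three pairwise incomparable atoms between a least and a greatest element. -/
inductive Diamond : Type u
  | bot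
  | atom (i : Fin 3)
  | top

namespace Diamond

/-- Joins in the diamond. -/
def sup : Diamond.{u} → Diamond.{u} → Diamond.{u}
  | bot, y => y
  | atom i, bot => atom i
  | atom i, atom j => if i = j then atom i else top
  | atom _, top => top
  | top, _ => top

/-- Meets in the diamond. -/
def inf : Diamond.{u} → Diamond.{u} → Diamond.{u}
  | bot, _ => bot
  | atom _, bot => bot
  | atom i, atom j => if i = j then atom i else bot
  | atom i, top => atom i
  | top, y => y

instance : Lattice Diamond.{u} where
  le x y := x = bot ∨ y = top ∨ x = y
  le_refl x := Or.inr (Or.inr rfl)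
  le_trans x y z := by grind
  le_antisymm x y := by grind
  sup := sup
  inf := inf
  le_sup_left x y := by cases x <;> cases y <;> grind [sup]
  le_sup_right x y := by cases x <;> cases y <;> grind [sup]
  sup_le x y z := by cases x <;> cases y <;> grind [sup]
  inf_le_left x y := by cases x <;> cases y <;> grind [inf]
  inf_le_right x y := by cases x <;> cases y <;> grind [inf]
  le_inf x y z := by cases y <;> cases z <;> grind [inf]

instance : BoundedOrder Diamond.{u} where
  top := top
  bot := bot
  le_top _ := Or.inr (Or.inl rfl)
  bot_le _ := Or.inl rfl

instance : Nontrivial Diamond.{u} := ⟨bot, top, by simp⟩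

theorem atom_ne_bot (i : Fin 3) : atom i ≠ (⊥ : Diamond.{u}) := Diamond.noConfusion

theorem atom_inf_atom {i j : Fin 3} (h : i ≠ j) : (atom i ⊓ atom j : Diamond.{u}) = ⊥ := if_neg h

theorem atom_sup_atom {i j : Fin 3} (h : i ≠ j) : (atom i ⊔ atom j : Diamond.{u}) = ⊤ := if_neg h

end Diamond

/-! ### The chains `D₃` and `D₅`. -/

namespace BZLat

open BZLattice

theorem chain_five_mem_AOL : chain.{u} 5 ∈ AOL := by
  refine ⟨⟨?_, ?_⟩, ?_⟩
  · rintro ⟨a⟩ ⟨b⟩ (h : a ≤ b) (k : ULift.up (min a.rev b) = ULift.up 0)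
    replace k := congrArg ULift.down k
    apply ULift.ext
    change a = b
    revert a b
    decide
  · rintro ⟨a⟩
    change br (ULift.up (min a a.rev)) = br (ULift.up a) ⊔ br (ULift.up a.rev)
    apply ULift.ext
    revert a
    decide
  · rintro ⟨a⟩ (h : ULift.up (max a a.rev) = ULift.up (Fin.rev 0))
    replace h := congrArg ULift.down h
    suffices a = 0 ∨ a = Fin.rev 0 from this.imp (congrArg ULift.up) (congrArg ULift.up)
    revert a
    decide

theorem chain_five_mem_DIST : chain.{u} 5 ∈ DIST := by
  refine ⟨chain_five_mem_AOL.1, ?_⟩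
  rintro ⟨a⟩ ⟨b⟩ ⟨c⟩
  exact congrArg ULift.up (inf_sup_left a b c)

theorem chain_five_mem_sdmMod : chain.{u} 5 ∈ sdmMod := by
  rw [mem_sdmMod]
  rintro ⟨a⟩ ⟨b⟩
  apply ULift.ext
  revert a b
  decide

theorem V_chain_five : V {chain.{u} 5} = SAOL ∩ DIST := by
  refine Set.Subset.antisymm (fun A hA => ?_) fun A hA =>
    DIST_inter_sdmMod_subset ⟨hA.2, mem_sdmMod.mpr hA.1.1.2⟩
  have h1 := isVariety_DIST.V_subset (Set.singleton_subset_iff.mpr chain_five_mem_DIST) hA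
  have h2 := isVariety_sdmMod.V_subset (Set.singleton_subset_iff.mpr chain_five_mem_sdmMod) hA
  exact ⟨⟨⟨h1.1, mem_sdmMod.mp h2⟩,
    V_mono (Set.singleton_subset_iff.mpr chain_five_mem_AOL) hA⟩, h1⟩

/-- The three-element chain is a subalgebra of the five-element one. -/
theorem chain_three_mem_V_chain_five : chain.{u} 3 ∈ V {chain.{u} 5} := by
  -- Bottom, middle and top: the middle is the fixed point of the involution in both chains.
  let e : Fin 3 → Fin 5 := ![0, 2, 4]
  refine mem_V_of_injective (subset_V _ rfl)
    (BZHom.ofFun (fun a : ULift.{u} (Fin 3) => (⟨e a.down⟩ : ULift.{u} (Fin 5))) ?_ ?_ rfl rfl ?_ ?_)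
    ?_
  · rintro ⟨a⟩ ⟨b⟩
    refine congrArg ULift.up (?_ : e (min a b) = min (e a) (e b))
    revert a b
    decide
  · rintro ⟨a⟩ ⟨b⟩
    refine congrArg ULift.up (?_ : e (max a b) = max (e a) (e b))
    revert a b
    decide
  · rintro ⟨a⟩
    refine congrArg ULift.up (?_ : e a.rev = (e a).rev)
    revert a
    decide
  · rintro ⟨a⟩
    apply ULift.ext
    revert a
    decide
  · rintro ⟨a⟩ ⟨b⟩ h
    replace h : e a = e b := congrArg ULift.down h
    apply ULift.ext
    revert a b
    decide

end BZLat

/-! ### Separating identities and counterexamples. -/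

namespace BZLat

open BZLattice

theorem inf_kl_of_mem_OML {A : BZLat.{u}} (hA : A ∈ OML) (a : A) : a ⊓ kl a = ⊥ := by
  rw [← hA.2, inf_br]

/-- The term `t ∧ t'`. -/
def Term.hat {X : Type} (t : Term X) : Term X := .inf t (.kl t)

theorem Term.mem_Mod_inf {X : Type} {s t : Term X} {A : BZLat.{u}} :
    A ∈ Mod (.inf s t) s ↔ ∀ v : X → A, s.eval v ≤ t.eval v :=
  forall_congr' fun _ => inf_eq_left

/-- The identity stating that `(x ∧ x') ∧ (y ∧ y')~~ ≤ y ∧ y'`. -/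
def hatSkMod : Set BZLat.{u} :=
  Mod (X := Fin 2) (.inf (.inf (.hat (.var 0)) (.br (.br (.hat (.var 1))))) (.hat (.var 1)))
    (.inf (.hat (.var 0)) (.br (.br (.hat (.var 1)))))

theorem mem_hatSkMod {A : BZLat.{u}} : A ∈ hatSkMod ↔
    ∀ a b : A, (a ⊓ kl a) ⊓ br (br (b ⊓ kl b)) ≤ b ⊓ kl b :=
  Term.mem_Mod_inf.trans ⟨fun h a b => h ![a, b], fun h v => h (v 0) (v 1)⟩

/-- The distributive inequality for elements of the form `x ∧ x'`. -/
def hatDistMod : Set BZLat.{u} :=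
  Mod (X := Fin 3)
    (.inf (.inf (.hat (.var 0)) (.sup (.hat (.var 1)) (.hat (.var 2))))
      (.sup (.inf (.hat (.var 0)) (.hat (.var 1))) (.inf (.hat (.var 0)) (.hat (.var 2)))))
    (.inf (.hat (.var 0)) (.sup (.hat (.var 1)) (.hat (.var 2))))

theorem mem_hatDistMod {A : BZLat.{u}} : A ∈ hatDistMod ↔ ∀ a b c : A,
    (a ⊓ kl a) ⊓ ((b ⊓ kl b) ⊔ (c ⊓ kl c)) ≤
      ((a ⊓ kl a) ⊓ (b ⊓ kl b)) ⊔ ((a ⊓ kl a) ⊓ (c ⊓ kl c)) :=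
  Term.mem_Mod_inf.trans ⟨fun h a b c => h ![a, b, c], fun h v => h (v 0) (v 1) (v 2)⟩

/-- The strong De Morgan inequality for elements of the form `x ∧ x'`. -/
def hatSdmMod : Set BZLat.{u} :=
  Mod (X := Fin 2)
    (.inf (.br (.inf (.hat (.var 0)) (.hat (.var 1))))
      (.sup (.br (.hat (.var 0))) (.br (.hat (.var 1)))))
    (.br (.inf (.hat (.var 0)) (.hat (.var 1))))

theorem mem_hatSdmMod {A : BZLat.{u}} : A ∈ hatSdmMod ↔ ∀ a b : A,
    br ((a ⊓ kl a) ⊓ (b ⊓ kl b)) ≤ br (a ⊓ kl a) ⊔ br (b ⊓ kl b) :=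
  Term.mem_Mod_inf.trans ⟨fun h a b => h ![a, b], fun h v => h (v 0) (v 1)⟩

/-- An identity expressing that the distributive inequality or the strong De Morgan inequality
holds for elements of the form `x ∧ x'`. -/
def hatDistOrSdmMod : Set BZLat.{u} :=
  Mod (X := Fin 3)
    (.inf (.inf (.inf (.br (.inf (.hat (.var 0)) (.hat (.var 1))))
        (.br (.sup (.br (.hat (.var 0))) (.br (.hat (.var 1))))))
      (.inf (.hat (.var 0)) (.sup (.hat (.var 1)) (.hat (.var 2)))))
      (.sup (.inf (.hat (.var 0)) (.hat (.var 1))) (.inf (.hat (.var 0)) (.hat (.var 2)))))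
    (.inf (.inf (.br (.inf (.hat (.var 0)) (.hat (.var 1))))
        (.br (.sup (.br (.hat (.var 0))) (.br (.hat (.var 1))))))
      (.inf (.hat (.var 0)) (.sup (.hat (.var 1)) (.hat (.var 2)))))

theorem mem_hatDistOrSdmMod {A : BZLat.{u}} : A ∈ hatDistOrSdmMod ↔ ∀ a b c : A,
    (br ((a ⊓ kl a) ⊓ (b ⊓ kl b)) ⊓ br (br (a ⊓ kl a) ⊔ br (b ⊓ kl b))) ⊓
        ((a ⊓ kl a) ⊓ ((b ⊓ kl b) ⊔ (c ⊓ kl c))) ≤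
      ((a ⊓ kl a) ⊓ (b ⊓ kl b)) ⊔ ((a ⊓ kl a) ⊓ (c ⊓ kl c)) :=
  Term.mem_Mod_inf.trans ⟨fun h a b c => h ![a, b, c], fun h v => h (v 0) (v 1) (v 2)⟩

/-- In `D₃` the midpoint is the only nonzero value of `x ∧ x'`. -/
theorem join_OML_chain_three_subset : join OML (V {chain.{u} 3}) ⊆ hatSkMod := by
  refine join_subset (isVariety_Mod _ _) (fun A hA => ?_)
    ((isVariety_Mod _ _).V_subset (Set.singleton_subset_iff.mpr ?_))
  · refine mem_hatSkMod.mpr fun a b => ?_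
    rw [inf_kl_of_mem_OML hA a, bot_inf_eq]
    exact bot_le
  · refine mem_hatSkMod.mpr ?_
    rintro ⟨a⟩ ⟨b⟩
    rw [← inf_eq_left]
    apply ULift.ext
    revert a b
    decide

theorem chain_five_not_mem_hatSkMod : chain.{u} 5 ∉ hatSkMod := fun h => by
  -- In `D₅` both `2` and `1` are values of `x ∧ x'`, and `1~~` is the top, so the identity would
  -- give `2 ≤ 1`.
  have := inf_eq_left.mpr (mem_hatSkMod.mp h ⟨2⟩ ⟨1⟩)
  exact absurd (congrArg ULift.down this) (by decide)

theorem join_OML_DIST_subset : join OML.{u} DIST ⊆ hatDistMod := by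
  refine join_subset (isVariety_Mod _ _) (fun A hA => ?_) fun A hA => ?_
  · refine mem_hatDistMod.mpr fun a b c => ?_
    rw [inf_kl_of_mem_OML hA a, bot_inf_eq]
    exact bot_le
  · exact mem_hatDistMod.mpr fun a b c => (hA.2 _ _ _).le

theorem join_OML_SAOL_subset : join OML.{u} SAOL ⊆ hatSdmMod := by
  refine join_subset (isVariety_Mod _ _) (fun A hA => ?_) fun A hA => ?_
  · refine mem_hatSdmMod.mpr fun a b => ?_
    rw [inf_kl_of_mem_OML hA a, br_bot, top_sup_eq]
    exact le_top
  · exact mem_hatSdmMod.mpr fun a b => (hA.1.2 _ _).le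

/-- Under strong De Morgan the guard `(x ∧ y)~ ∧ (x~ ∨ y~)~` has the form `w ∧ w~ = 0`; under
distributivity the rest of the inequality holds. The guard is `1` for disjoint nonzero elements with
trivial `~`. -/
theorem join_join_subset : join (join OML.{u} SAOL) DIST ⊆ hatDistOrSdmMod := by
  refine join_subset (isVariety_Mod _ _) (join_subset (isVariety_Mod _ _) (fun A hA => ?_)
    fun A hA => ?_) fun A hA => ?_
  · refine mem_hatDistOrSdmMod.mpr fun a b c => ?_
    rw [inf_kl_of_mem_OML hA a, bot_inf_eq ((b ⊓ kl b) ⊔ (c ⊓ kl c)), inf_bot_eq]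
    exact bot_le
  · refine mem_hatDistOrSdmMod.mpr fun a b c => ?_
    rw [hA.1.2, inf_br, bot_inf_eq]
    exact bot_le
  · exact mem_hatDistOrSdmMod.mpr fun a b c => inf_le_right.trans (hA.2 _ _ _).le

/-- A distributive antiortholattice violating the strong De Morgan identity. -/
theorem DIST_not_subset : ¬ DIST.{u} ⊆ join OML SAOL := fun h => by
  have hA : (⟨Stack (Set (ULift.{u} Bool))⟩ : BZLat.{u}) ∈ DIST := Stack.mem_DIST inf_sup_left
  have := mem_hatSdmMod.mp (join_OML_SAOL_subset (h hA)) (Stack.lo {⟨true⟩}) (Stack.lo {⟨false⟩})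
  have hdisj : ({⟨true⟩} ⊓ {⟨false⟩} : Set (ULift.{u} Bool)) = ⊥ := by
    ext x; simp +contextual
  have hne : ∀ x : ULift.{u} Bool, (Stack.lo {x} : Stack (Set (ULift.{u} Bool))) ≠ ⊥ := fun x hx =>
    Set.singleton_ne_empty x (Stack.lo.inj hx)
  rw [Stack.lo_inf_kl, Stack.lo_inf_kl, Stack.lo_inf_lo, hdisj, ← Stack.bot_def, br_bot,
    Stack.br_of_ne_bot (hne _), Stack.br_of_ne_bot (hne _), sup_bot_eq] at this
  exact absurd (le_bot_iff.mp this) (by rw [Stack.top_def, Stack.bot_def]; simp)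

/-- A non-distributive antiortholattice satisfying the strong De Morgan identity. -/
theorem SAOL_not_subset : ¬ SAOL.{u} ⊆ join OML DIST := fun h => by
  -- The new bottom makes meets of nonzero elements nonzero, while the diamond above it still breaks
  -- distributivity.
  have hA : (⟨Stack (WithBot Diamond.{u})⟩ : BZLat.{u}) ∈ SAOL := Stack.mem_SAOL fun a b hab => by
    cases a with
    | bot => exact Or.inl rfl
    | coe a =>
      cases b with
      | bot => exact Or.inr rfl
      | coe b => exact absurd hab WithBot.coe_ne_bot
  let x : Fin 3 → Stack (WithBot Diamond.{u}) := fun i => .lo (Diamond.atom i : Diamond.{u})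
  have := mem_hatDistMod.mp (join_OML_DIST_subset (h hA)) (x 0) (x 1) (x 2)
  simp only [x, Stack.lo_inf_kl, Stack.lo_inf_lo, Stack.lo_sup_lo, ← WithBot.coe_inf,
    ← WithBot.coe_sup, Diamond.atom_inf_atom (i := 0) (j := 1) (by decide),
    Diamond.atom_inf_atom (i := 0) (j := 2) (by decide),
    Diamond.atom_sup_atom (i := 1) (j := 2) (by decide), inf_top_eq, sup_idem] at this
  have : ((Diamond.atom 0 : Diamond.{u}) : WithBot Diamond.{u}) ≤ (⊥ : Diamond.{u}) := this
  exact Diamond.atom_ne_bot 0 (le_bot_iff.mp (WithBot.coe_le_coe.mp this))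

/-- A non-distributive antiortholattice violating the strong De Morgan identity. -/
theorem V_AOL_not_subset : ¬ V AOL.{u} ⊆ join (join OML SAOL) DIST := fun h => by
  -- Without an added bottom the atoms are disjoint, so both laws fail on the same elements.
  have hA : (⟨Stack Diamond.{u}⟩ : BZLat.{u}) ∈ V AOL := subset_V _ Stack.mem_AOL
  let x : Fin 3 → Stack Diamond.{u} := fun i => .lo (.atom i)
  have := mem_hatDistOrSdmMod.mp (join_join_subset (h hA)) (x 0) (x 1) (x 2)
  have hne : ∀ i, br (Stack.lo (Diamond.atom i : Diamond.{u})) = ⊥ := fun i =>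
    Stack.br_of_ne_bot fun hi => Diamond.atom_ne_bot i (Stack.lo.inj hi)
  simp only [x, Stack.lo_inf_kl, Stack.lo_inf_lo, Stack.lo_sup_lo, hne,
    Diamond.atom_inf_atom (i := 0) (j := 1) (by decide),
    Diamond.atom_inf_atom (i := 0) (j := 2) (by decide),
    Diamond.atom_sup_atom (i := 1) (j := 2) (by decide), inf_top_eq, sup_idem, br_bot,
    top_inf_eq, ← Stack.bot_def] at this
  have : (Diamond.atom 0 : Diamond.{u}) ≤ ⊥ := this
  exact Diamond.atom_ne_bot 0 (le_bot_iff.mp this)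

end BZLat

/-! ### Assembly of the main theorem. -/

theorem mainTheorem9 :
    -- the joins with `DIST` and `V(D₅)` are subdirect products
    (BZLat.join BZLat.OML.{u} BZLat.DIST = BZLat.subdirectProduct BZLat.OML BZLat.DIST ∧
      BZLat.join BZLat.OML.{u} (BZLat.V {BZLat.chain 5}) =
        BZLat.subdirectProduct BZLat.OML (BZLat.V {BZLat.chain 5})) ∧
    -- the chain of inclusions
    (BZLat.join BZLat.OML.{u} (BZLat.V {BZLat.chain 3}) ⊂
        BZLat.join BZLat.OML (BZLat.V {BZLat.chain 5}) ∧
      BZLat.join BZLat.OML.{u} (BZLat.V {BZLat.chain 5}) =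
        BZLat.join BZLat.OML (BZLat.SAOL ∩ BZLat.DIST) ∧
      BZLat.join BZLat.OML.{u} (BZLat.SAOL ∩ BZLat.DIST) =
        BZLat.join BZLat.OML BZLat.SAOL ∩ BZLat.join BZLat.OML BZLat.DIST ∧
      BZLat.join BZLat.OML.{u} BZLat.SAOL ∩ BZLat.join BZLat.OML BZLat.DIST ⊂
        BZLat.join BZLat.OML BZLat.SAOL ∧
      BZLat.join BZLat.OML.{u} BZLat.SAOL ∩ BZLat.join BZLat.OML BZLat.DIST ⊂
        BZLat.join BZLat.OML BZLat.DIST ∧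
      BZLat.join BZLat.OML.{u} BZLat.SAOL ⊂
        BZLat.join (BZLat.join BZLat.OML BZLat.SAOL) BZLat.DIST ∧
      BZLat.join BZLat.OML.{u} BZLat.DIST ⊂
        BZLat.join (BZLat.join BZLat.OML BZLat.SAOL) BZLat.DIST ∧
      BZLat.join (BZLat.join BZLat.OML.{u} BZLat.SAOL) BZLat.DIST ⊂
        BZLat.join BZLat.OML (BZLat.V BZLat.AOL)) ∧
    -- incomparability
    (¬ BZLat.join BZLat.OML.{u} BZLat.SAOL ⊆ BZLat.join BZLat.OML BZLat.DIST ∧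
      ¬ BZLat.join BZLat.OML.{u} BZLat.DIST ⊆ BZLat.join BZLat.OML BZLat.SAOL) := by
  open BZLat in
  have hS : ¬ join OML.{u} SAOL ⊆ join OML DIST := fun h =>
    SAOL_not_subset ((subset_join_right _ _).trans h)
  have hD : ¬ join OML.{u} DIST ⊆ join OML SAOL := fun h =>
    DIST_not_subset ((subset_join_right _ _).trans h)
  have hDJ : join OML.{u} DIST ⊆ join (join OML SAOL) DIST :=
    join_subset (isVariety_join _ _) ((subset_join_left _ _).trans (subset_join_left _ _))
      (subset_join_right _ _)
  refine ⟨⟨join_eq_subdirectProduct isVariety_OML isVariety_DIST,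
    join_eq_subdirectProduct isVariety_OML (isVariety_V _)⟩,
    ⟨⟨?_, fun h => ?_⟩, by rw [V_chain_five], ?_, ⟨Set.inter_subset_left, fun h => ?_⟩,
      ⟨Set.inter_subset_right, fun h => ?_⟩, ⟨subset_join_left _ _, fun h => ?_⟩,
      ⟨hDJ, fun h => ?_⟩, ⟨?_, fun h => ?_⟩⟩, hS, hD⟩
  · exact join_mono ((isVariety_V _).V_subset
      (Set.singleton_subset_iff.mpr chain_three_mem_V_chain_five))
  · exact chain_five_not_mem_hatSkMod (join_OML_chain_three_subset
      (h (subset_join_right _ _ (subset_V _ rfl))))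
  · refine Set.Subset.antisymm (Set.subset_inter (join_mono Set.inter_subset_left)
      (join_mono Set.inter_subset_right)) ?_
    -- `SAOL` is enlarged to a class visibly closed under HSP, dropping paraorthomodularity;
    -- intersecting with `DIST` restores it.
    have h : SAOL.{u} ⊆ sdmMod ∩ V AOL := fun A hA => ⟨mem_sdmMod.mpr hA.1.2, hA.2⟩
    refine (Set.inter_subset_inter_left _ (join_mono h)).trans
      ((join_inter_join_subset isVariety_OML (isVariety_sdmMod.inter (isVariety_V _))
        isVariety_DIST).trans (join_mono ?_))
    rintro A ⟨⟨h1, h2⟩, h3⟩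
    exact ⟨⟨⟨h3.1, mem_sdmMod.mp h1⟩, h2⟩, h3⟩
  · exact hS (h.trans Set.inter_subset_right)
  · exact hD (h.trans Set.inter_subset_left)
  · exact hD (hDJ.trans h)
  · exact hS ((subset_join_left _ _).trans h)
  · exact join_subset (isVariety_join _ _) (join_mono Set.inter_subset_right)
      (DIST_subset_V_AOL.trans (subset_join_right _ _))
  · exact V_AOL_not_subset ((subset_join_right _ _).trans h)
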